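/- **Setting.** Let $\Omega\subset\mathbb R^3$ be a bounded, simply connected domain whose boundary $\Gamma=\partial\Omega$ has finite surface measure $\varsigma$ (the two-dimensional Hausdorff measure on $\Gamma$), with outward unit normal $n$ on $\Gamma$, defined at the points where $\Omega$ has a tangent half-space (almost everywhere if $\Gamma$ is Lipschitz) and set to $0$ elsewhere. Put $X=L^2(\Omega;\mathbb R^3)$ and $H(\operatorname{curl};\Omega)=\{V\in X:\operatorname{curl}V\in X\}$ (distributional curl). For $V\in H(\operatorname{curl};\Omega)$, $V\times n=0$ means $\int_\Omega \operatorname{curl}V\cdot P\,dx=\int_\Omega V\cdot\operatorname{curl}P\,dx$ for all $P\in H(\operatorname{curl};\Omega)$. Let $$\mathcal H=\{v\in H^1_0(\Omega):\ \Delta v\in L^2(\Omega),\ \partial_n v\in L^2(\Gamma)\},\qquad \|v\|_{\mathcal H}^2=\|v\|_{H^1(\Omega)}^2+\|\Delta v\|_{L^2(\Omega)}^2+\|\partial_nv\|_{L^2(\Gamma)}^2,$$ where $\Delta v$ is the distributional Laplacian and $\partial_n v$ is defined by Green's formula $\int_\Omega(\nabla v\cdot\nabla\psi+\psi\,\Delta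 v)\,dx=\int_\Gamma \psi\,\partial_n v\,d\varsigma$ for all $\psi\in C_c^\infty(\mathbb R^3)$. Assume that there is $C>0$ such that for every $g\in L^2(\Omega)$ there is a unique $w\in\mathcal H$ with $\int_\Omega\nabla w\cdot\nabla v\,dx=\int_\Omega g\,v\,dx$ for all $v\in H^1_0(\Omega)$, and $\|w\|_{\mathcal H}\le C\|g\|_{L^2(\Omega)}$. Let $T,q,m,c>0$, $r_0,p_0\in\mathbb R^3$, $E_0,B_0\in X$, and let $\varphi\in C^{2,1}(\mathbb R^3)$ be nonnegative and rotationally symmetric, with $\int_{\mathbb R^3}\varphi\,dx=1$ and support in a ball $\{|x|\le R\}$, $R>0$. For $p\in\mathbb R^3$ set $v(p)=\dfrac{p}{m\sqrt{1+|p|^2/(mc)^2}}$ and $\beta(p)=c^{-1}v(p)$. Let $\mathcal A(V_1,V_2)=(-\operatorname{curl}V_2,\operatorname{curl}V_1)$ be the Maxwell operator on $X\times X$ with domain $\{(V_1,V_2)\in H(\operatorname{curl};\Omega)^2: V_1\times n=0\}$, and let $(\mathcal G(t))_{t\ge0}$ be the $C_0$-semigroup on $X\times X$ generated by $-\mathcal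 A$. Given $u\in L^2(\Gamma)$, a pair $y=(w,z)\in C^1_{\{0\}}([0,T];\mathbb R^3)^2$ (continuously differentiable on $[0,T]$ and vanishing at $t=0$) is a solution of the *reduced state system* if, with $r=w+r_0$ and $p=z+p_0$, for all $t\in[0,T]$, $$\dot w(t)=v(p(t)),$$ $$\dot z(t)=q\int_\Omega\varphi(x-r(t))\big[E(x,t)+\beta(p(t))\times B(x,t)\big]dx-q\int_\Omega\eta(x)\,\nabla\varphi(x-r(t))\times\beta(p(t))\,dx+q\int_\Gamma u(x)\,\varphi(x-r(t))\,\beta(p(t))\times n(x)\,d\varsigma(x),$$ where $(E,B)\in C([0,T];X)^2$ is the mild solution of Maxwell's equations $$\binom{E(t)}{B(t)}=\mathcal G(t)\binom{E_0}{B_0}+\int_0^t\mathcal G(t-\tau)\binom{-q\,\varphi(\cdot-r(\tau))\,v(p(\tau))}{0}\,d\tau,$$ and $\eta\in L^2(\Omega)$ is the very weak solution of $-\Delta\eta=0$ in $\Omega$, $\eta=u$ on $\Gamma$, that is, $-\int_\Omega\eta\,\Delta v\,dx+\int_\Gamma u\,\partial_nv\,d\varsigma=0$ for all $v\in\mathcal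 H$. **Theorem.** There are constants $C_1,C_2>0$ such that for every $u\in L^2(\Gamma)$ the reduced state system has exactly one solution $y=(w,z)\in C^1_{\{0\}}([0,T];\mathbb R^3)^2$, and it satisfies $$\|y\|_{C^1([0,T];\mathbb R^3)^2}\le C_1\|u\|_{L^2(\Gamma)}+C_2 .$$ (That $\mathcal G$ and $\eta$ exist is part of the assertion.) -/

import Mathlib

open MeasureTheory Set Filter Topology
open scoped ContDiff

noncomputable section

namespace Abraham

/-! ### Euclidean space, vector calculus, surface measure and normal -/

/-- `ℝ³` with the Euclidean norm. -/
abbrev R3 : Type := EuclideanSpace ℝ (Fin 3)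

/-- The cross product on Euclidean `ℝ³`. -/
def cross (a b : R3) : R3 := WithLp.toLp 2 (crossProduct a.ofLp b.ofLp)

/-- The classical partial derivative `∂ᵢ ψⱼ (x)` of a vector field. -/
def partialD (ψ : R3 → R3) (i j : Fin 3) (x : R3) : ℝ :=
  fderiv ℝ ψ x (EuclideanSpace.single i 1) j

/-- The classical curl of a vector field. -/
def curl (ψ : R3 → R3) (x : R3) : R3 :=
  !₂[partialD ψ 1 2 x - partialD ψ 2 1 x,
     partialD ψ 2 0 x - partialD ψ 0 2 x,
     partialD ψ 0 1 x - partialD ψ 1 0 x]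

/-- Test functions on `Ω`: smooth, with compact support contained in `Ω`. -/
def IsTest {F : Type} [NormedAddCommGroup F] [NormedSpace ℝ F] (Ω : Set R3) (ψ : R3 → F) : Prop :=
  ContDiff ℝ ∞ ψ ∧ HasCompactSupport ψ ∧ tsupport ψ ⊆ Ω

/-- Lebesgue measure on `Ω`. -/
abbrev vol (Ω : Set R3) : Measure R3 := volume.restrict Ω

/-- The surface measure on `Γ = ∂Ω`: two-dimensional Hausdorff measure, normalized so that it is
the usual area on planes. -/
def surf (Ω : Set R3) : Measure R3 := (Measure.euclideanHausdorffMeasure 2).restrict (frontier Ω)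

/-- `ν` is the outward unit normal to `Ω` at `x`: seen from `x`, the set `Ω` is asymptotically the
half-space `{y | ⟪y - x, ν⟫ < 0}`. Such a `ν` is unique if it exists; on Lipschitz domains it exists
almost everywhere on the boundary. -/
def IsOutwardUnitNormal (Ω : Set R3) (x ν : R3) : Prop :=
  ‖ν‖ = 1 ∧ ∀ ε > 0, ∃ δ > 0, ∀ y : R3, dist y x < δ →
    (inner ℝ (y - x) ν < -ε * ‖y - x‖ → y ∈ Ω) ∧ (ε * ‖y - x‖ < inner ℝ (y - x) ν → y ∉ Ω)

open Classical in
/-- The outward unit normal field `n` (with value `0` at points where there is no normal). -/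
def outwardNormal (Ω : Set R3) (x : R3) : R3 :=
  if h : ∃ ν, IsOutwardUnitNormal Ω x ν then h.choose else 0

/-! ### Function spaces -/

/-- `L²(Ω)`. -/
abbrev L2 (Ω : Set R3) : Type := Lp ℝ 2 (vol Ω)

/-- `X = L²(Ω; ℝ³)`. -/
abbrev X (Ω : Set R3) : Type := Lp R3 2 (vol Ω)

/-- `X × X` with its Hilbert space structure. -/
abbrev XX (Ω : Set R3) : Type := WithLp 2 (X Ω × X Ω)

/-- `L²(Γ)`. -/
abbrev L2Γ (Ω : Set R3) : Type := Lp ℝ 2 (surf Ω)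

/-- `V ∈ H(curl; Ω)` with distributional curl `W ∈ X`. -/
def HasWeakCurl (Ω : Set R3) (V W : X Ω) : Prop :=
  ∀ ψ : R3 → R3, IsTest Ω ψ →
    ∫ x, inner ℝ (V x) (curl ψ x) ∂(vol Ω) = ∫ x, inner ℝ (W x) (ψ x) ∂(vol Ω)

/-- `V ∈ H(curl; Ω)` with curl `W`, and the tangential trace `V × n` vanishes, that is, the boundary
term in Green's formula for the curl vanishes against every field in `H(curl; Ω)`. -/
def HasWeakCurlZeroTrace (Ω : Set R3) (V W : X Ω) : Prop :=
  HasWeakCurl Ω V W ∧ ∀ P Q : X Ω, HasWeakCurl Ω P Q → inner ℝ W P = inner ℝ V Q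

/-- `F ∈ H(div; Ω)` with distributional divergence `d ∈ L²(Ω)`. -/
def HasWeakDiv (Ω : Set R3) (F : X Ω) (d : L2 Ω) : Prop :=
  ∀ ψ : R3 → ℝ, IsTest Ω ψ →
    ∫ x, inner ℝ (F x) (gradient ψ x) ∂(vol Ω) = - ∫ x, d x * ψ x ∂(vol Ω)

/-- The normal trace `F · n` of a field `F` with divergence `d` is the function `g ∈ L²(Γ)`, in the
sense of Green's formula. -/
def HasNormalTrace (Ω : Set R3) (F : X Ω) (d : L2 Ω) (g : L2Γ Ω) : Prop :=
  ∀ ψ : R3 → ℝ, ContDiff ℝ ∞ ψ → HasCompactSupport ψ →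
    ∫ x, inner ℝ (F x) (gradient ψ x) ∂(vol Ω) + ∫ x, d x * ψ x ∂(vol Ω) =
      ∫ x, g x * ψ x ∂(surf Ω)

/-- `v ∈ H¹₀(Ω)` with weak gradient `G`: the pair `(v, G)` is a limit in `L²(Ω) × L²(Ω; ℝ³)` of pairs
`(ψ, ∇ψ)` with test functions `ψ` on `Ω`. -/
def IsH10 (Ω : Set R3) (v : L2 Ω) (G : X Ω) : Prop :=
  (v, G) ∈ closure {P : L2 Ω × X Ω | ∃ ψ : R3 → ℝ, IsTest Ω ψ ∧
    P.1 =ᵐ[vol Ω] ψ ∧ P.2 =ᵐ[vol Ω] gradient ψ}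

/-- The space `𝓗` of all `v ∈ H¹₀(Ω)` with `∇v ∈ H(div; Ω)` and `∂ₙv ∈ L²(Γ)`. An element is recorded
together with `∇v`, `Δv` and `∂ₙv`, which are determined by `v`. -/
structure HSpace (Ω : Set R3) where
  /-- the function `v` -/
  val : L2 Ω
  /-- the gradient `∇v` -/
  grad : X Ω
  /-- the Laplacian `Δv` -/
  lap : L2 Ω
  /-- the normal derivative `∂ₙv` -/
  normalDeriv : L2Γ Ω
  isH10 : IsH10 Ω val grad
  hasWeakDiv : HasWeakDiv Ω grad lap
  hasNormalTrace : HasNormalTrace Ω grad lap normalDeriv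

/-- The norm of `𝓗`. -/
def HSpace.hnorm {Ω : Set R3} (v : HSpace Ω) : ℝ :=
  Real.sqrt (‖v.val‖ ^ 2 + ‖v.grad‖ ^ 2 + ‖v.lap‖ ^ 2 + ‖v.normalDeriv‖ ^ 2)

/-- `w ∈ 𝓗` solves `-Δw = g`, `w = 0` on `Γ`, in the weak sense. -/
def IsWeakPoisson (Ω : Set R3) (g : L2 Ω) (w : HSpace Ω) : Prop :=
  ∀ (v : L2 Ω) (G : X Ω), IsH10 Ω v G →
    ∫ x, inner ℝ (w.grad x) (G x) ∂(vol Ω) = ∫ x, g x * v x ∂(vol Ω)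

/-- The regularity assumption on the domain: for every `g ∈ L²(Ω)` the homogeneous Dirichlet problem
has a unique weak solution in `𝓗`, with `‖w‖_𝓗 ≤ C ‖g‖`. -/
def PoissonRegular (Ω : Set R3) : Prop :=
  ∃ C > 0, ∀ g : L2 Ω, (∃! w : HSpace Ω, IsWeakPoisson Ω g w) ∧
    ∀ w : HSpace Ω, IsWeakPoisson Ω g w → w.hnorm ≤ C * ‖g‖

/-- `η ∈ L²(Ω)` is the very weak solution of `-Δη = 0` in `Ω`, `η = u` on `Γ`. -/
def IsVeryWeakSolution (Ω : Set R3) (u : L2Γ Ω) (η : L2 Ω) : Prop :=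
  ∀ v : HSpace Ω,
    -(∫ x, η x * v.lap x ∂(vol Ω)) + ∫ x, u x * v.normalDeriv x ∂(surf Ω) = 0

/-! ### Maxwell's equations -/

/-- The graph of the Maxwell operator: `V` lies in the domain of `𝒜` and `𝒜 V = W`, where
`𝒜 (V₁, V₂) = (-curl V₂, curl V₁)` for `V₁, V₂ ∈ H(curl; Ω)` with `V₁ × n = 0`. -/
def IsMaxwellOp (Ω : Set R3) (V W : XX Ω) : Prop :=
  HasWeakCurlZeroTrace Ω V.fst W.snd ∧ HasWeakCurl Ω V.snd (-W.fst)

/-- `G` is a `C₀`-semigroup on `H` (only the values at `t ≥ 0` matter). -/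
structure IsC0Semigroup {H : Type} [NormedAddCommGroup H] [NormedSpace ℝ H]
    (G : ℝ → H →L[ℝ] H) : Prop where
  zero : G 0 = ContinuousLinearMap.id ℝ H
  add : ∀ s t : ℝ, 0 ≤ s → 0 ≤ t → G (s + t) = (G s).comp (G t)
  tendsto : ∀ V : H, Tendsto (fun t => G t V) (𝓝[>] 0) (𝓝 V)

/-- `V` lies in the domain of the infinitesimal generator of `G`, which maps it to `W`. -/
def IsGenerator {H : Type} [NormedAddCommGroup H] [NormedSpace ℝ H]
    (G : ℝ → H →L[ℝ] H) (V W : H) : Prop :=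
  Tendsto (fun h : ℝ => h⁻¹ • (G h V - V)) (𝓝[>] 0) (𝓝 W)

/-- `G` is the `C₀`-semigroup of the homogeneous Maxwell system `∂ₜ V + 𝒜 V = 0`, that is, the
`C₀`-semigroup whose infinitesimal generator is `-𝒜`, with equality of domains. -/
def IsMaxwellSemigroup (Ω : Set R3) (G : ℝ → XX Ω →L[ℝ] XX Ω) : Prop :=
  IsC0Semigroup G ∧ ∀ V W : XX Ω, IsGenerator G V W ↔ IsMaxwellOp Ω V (-W)

/-- `V = (E, B) ∈ C([0,T]; X)²` is the mild solution of `∂ₜ V + 𝒜 V = j`, `V(0) = V₀`. -/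
def IsMildSolution (Ω : Set R3) (T : ℝ) (V₀ : XX Ω) (j V : ℝ → XX Ω) : Prop :=
  ContinuousOn V (Icc 0 T) ∧ ∃ G : ℝ → XX Ω →L[ℝ] XX Ω, IsMaxwellSemigroup Ω G ∧
    ∀ t ∈ Icc 0 T, V t = G t V₀ + ∫ τ in (0 : ℝ)..t, G (t - τ) (j τ)

/-! ### The particle -/

/-- The Lorentz factor `γ(p)`, with rest mass `m` and speed of light `c`. -/
def lorentzFactor (m c : ℝ) (p : R3) : ℝ := Real.sqrt (1 + ‖p‖ ^ 2 / (m * c) ^ 2)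

/-- The velocity `v(p) = p / (m γ(p))`. -/
def velocity (m c : ℝ) (p : R3) : R3 := (m * lorentzFactor m c p)⁻¹ • p

/-- `β(p) = v(p) / c`. -/
def beta (m c : ℝ) (p : R3) : R3 := c⁻¹ • velocity m c p

/-- A smeared out delta distribution: a nonnegative, rotationally symmetric function of class
`C^{2,1}` with integral one, supported in a ball of radius `R` around the origin. -/
structure SmearedDelta where
  /-- the function itself -/
  φ : R3 → ℝ
  /-- the radius of the ball -/
  R : ℝ
  R_pos : 0 < R
  contDiff : ContDiff ℝ 2 φ
  lipschitz : ∃ K, LipschitzWith K (iteratedFDeriv ℝ 2 φ)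
  support : tsupport φ ⊆ Metric.closedBall 0 R
  nonneg : ∀ x, 0 ≤ φ x
  integral : ∫ x, φ x = 1
  radial : ∀ x y : R3, ‖x‖ = ‖y‖ → φ x = φ y

theorem SmearedDelta.hasCompactSupport (D : SmearedDelta) : HasCompactSupport D.φ :=
  (isCompact_closedBall (0 : R3) D.R).of_isClosed_subset (isClosed_tsupport _) D.support

theorem SmearedDelta.memLp (D : SmearedDelta) (Ω : Set R3) (a : ℝ) (r b : R3) :
    MemLp (fun x => (a * D.φ (x - r)) • b) 2 (vol Ω) := by
  have hc : Continuous (fun x => D.φ (x - r)) :=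
    D.contDiff.continuous.comp (continuous_id.sub continuous_const)
  have hs : HasCompactSupport (fun x => D.φ (x - r)) := by
    have h := D.hasCompactSupport.comp_homeomorph (Homeomorph.subRight r)
    exact h
  have h1 : Continuous (fun x => (a * D.φ (x - r)) • b) :=
    (continuous_const.mul hc).smul continuous_const
  refine (h1.memLp_of_hasCompactSupport (μ := volume) ?_).restrict Ω
  exact (hs.mul_left (f := fun _ => a)).smul_right (f' := fun _ => b)

/-- The current density `j(r,p) = (-q φ(· - r) v(p), 0) ∈ X × X` for position `r` and momentum `p`. -/
def current (Ω : Set R3) (D : SmearedDelta) (q m c : ℝ) (r p : R3) : XX Ω :=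
  WithLp.toLp 2 ((D.memLp Ω (-q) r (velocity m c p)).toLp, 0)

/-- The force on the particle with position `r` and momentum `p`: the smeared Lorentz force of the
fields `V = (E, B)`, the contribution of the potential `η` and that of its boundary values `u`. -/
def force (Ω : Set R3) (D : SmearedDelta) (q m c : ℝ) (u : L2Γ Ω) (η : L2 Ω) (V : XX Ω)
    (r p : R3) : R3 :=
  q • (∫ x, D.φ (x - r) • (V.fst x + cross (beta m c p) (V.snd x)) ∂(vol Ω))
    - q • (∫ x, η x • cross (gradient D.φ (x - r)) (beta m c p) ∂(vol Ω))
    + q • (∫ x, (u x * D.φ (x - r)) • cross (beta m c p) (outwardNormal Ω x) ∂(surf Ω))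

/-- `w ∈ C¹_{0}([0,T]; ℝ³)`: continuously differentiable on `[0,T]` and vanishing at `0`. Only the
values on `[0,T]` matter. -/
def IsC1Zero (T : ℝ) (w : ℝ → R3) : Prop := ContDiffOn ℝ 1 w (Icc 0 T) ∧ w 0 = 0

/-- The norm of `y = (w, z)` in `C¹([0,T]; ℝ³)²`, with the Euclidean norm on `ℝ³ × ℝ³`. -/
def c1Norm (T : ℝ) (w z : ℝ → R3) : ℝ :=
  (⨆ t : Icc (0 : ℝ) T, ‖(WithLp.toLp 2 (w t, z t) : WithLp 2 (R3 × R3))‖) +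
  ⨆ t : Icc (0 : ℝ) T, ‖(WithLp.toLp 2 (derivWithin w (Icc 0 T) t, derivWithin z (Icc 0 T) t) :
    WithLp 2 (R3 × R3))‖

/-- `y = (w, z) ∈ C¹_{0}([0,T]; ℝ³)²` solves the reduced state system with control `u`: with
`r = w + r₀`, `p = z + p₀`, the Newton–Lorentz equations hold on `[0,T]`, where `V = (E, B)` is the
mild solution of Maxwell's equations with current `j(r,p)` and `η` is the very weak solution of the
Poisson equation with boundary data `u`. -/
def IsReducedSolution (Ω : Set R3) (T : ℝ) (D : SmearedDelta) (q m c : ℝ) (r₀ p₀ : R3)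
    (E₀ B₀ : X Ω) (u : L2Γ Ω) (w z : ℝ → R3) : Prop :=
  IsC1Zero T w ∧ IsC1Zero T z ∧
  ∃ (V : ℝ → XX Ω) (η : L2 Ω),
    IsMildSolution Ω T (WithLp.toLp 2 (E₀, B₀))
      (fun t => current Ω D q m c (w t + r₀) (z t + p₀)) V ∧
    IsVeryWeakSolution Ω u η ∧
    ∀ t ∈ Icc 0 T,
      derivWithin z (Icc 0 T) t = force Ω D q m c u η (V t) (w t + r₀) (z t + p₀) ∧
      derivWithin w (Icc 0 T) t = velocity m c (z t + p₀)

end Abraham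

end

/-! The system is a Volterra equation `y = ∫₀ Φ y` for the trajectory alone. Once the Maxwell
semigroup and the very weak solution `η` are known, the fields at time `t` are given by Duhamel's
formula from the trajectory on `[0,t]`. The map `Φ` (`stateRhs`) is then causal and globally
Lipschitz, so Picard iteration works on all of `[0,T]` without a smallness condition.

The Maxwell operator is skew-symmetric by Green's formula, and `1 + ε𝒜` is onto because the closed
graph of `ε curl` and its orthogonal complement span `X × X`; the complement consists, up to swap
and sign, of fields with vanishing tangential trace together with their curls
(`isMaximalSkew_maxwellGraph`). For such operators the Yosida approximation yields a contraction
semigroup with exactly the right generator (`IsMaximalSkew.isGenerator_iff`). It is the only such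
semigroup for nonnegative times (`IsMaximalSkew.eq_semigroup`), so the notion of mild solution is
unambiguous.

The very weak solution is obtained by transposition: `η` is minus the adjoint of the map from `g` to
the normal derivative of the solution of the Poisson problem, applied to `u`
(`exists_isVeryWeakSolution_iff`). Hence `‖η‖ ≤ ‖S‖ ‖u‖`.

The current is bounded and Lipschitz in position and momentum, since velocities are bounded by `c`
and Lipschitz in the momentum. The force is a pairing of square integrable functions with smooth
translated kernels, so it is linear in the size of `(V, η, u)` and Lipschitz in position and
momentum (`exists_force_bound`). Since the semigroup contracts, the fields are bounded on `[0,T]`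
independently of the trajectory. This gives both the Lipschitz constant of `Φ`
(`exists_isCausal_stateRhs`) and the affine a priori bound in `‖u‖`. An iterate of the Picard map is
a contraction because the iterated integrals produce the factor `(LT)ⁿ/n!`
(`IsCausal.exists_contracting`). -/

noncomputable section

namespace Abraham

/-! ### Skew-symmetric operators and their semigroups -/

section Semigroup

variable {H : Type} [NormedAddCommGroup H] [InnerProductSpace ℝ H]

/-- The graph of a skew-symmetric operator `A` for which `1 + εA` is onto for all `ε > 0`. -/
structure IsMaximalSkew (A : Submodule ℝ (H × H)) : Prop where
  skew : ∀ V W, (V, W) ∈ A → inner ℝ V W = 0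
  range : ∀ ε : ℝ, 0 < ε → ∀ f, ∃ V W, (V, W) ∈ A ∧ V + ε • W = f
  single : ∀ W, (0, W) ∈ A → W = 0

variable {A : Submodule ℝ (H × H)}

/-- `V` has norm at most that of `V + εW`. -/
theorem IsMaximalSkew.norm_le (hA : IsMaximalSkew A) {V W : H} (h : (V, W) ∈ A) (ε : ℝ) :
    ‖V‖ ≤ ‖V + ε • W‖ := by
  have h0 := hA.skew V W h
  have : ‖V + ε • W‖ ^ 2 = ‖V‖ ^ 2 + ‖ε • W‖ ^ 2 := by
    rw [norm_add_sq_real, real_inner_smul_right, h0]; ring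
  exact le_of_sq_le_sq (by nlinarith [sq_nonneg ‖ε • W‖]) (norm_nonneg _)

theorem IsMaximalSkew.eq_of_add_eq (hA : IsMaximalSkew A) {V W V' W' : H} (h : (V, W) ∈ A)
    (h' : (V', W') ∈ A) {ε : ℝ} (he : V + ε • W = V' + ε • W') : V = V' := by
  have h1 := hA.norm_le (A.sub_mem h h') ε
  have h2 : (V - V') + ε • (W - W') = 0 := by
    rw [smul_sub, sub_add_sub_comm, he, sub_self]
  rw [h2, norm_zero] at h1
  exact sub_eq_zero.1 (norm_le_zero_iff.1 h1)

/-- The domain of the operator with graph `A`. -/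
abbrev graphDomain (A : Submodule ℝ (H × H)) : Submodule ℝ H := A.map (LinearMap.fst ℝ H H)

theorem mem_graphDomain {V : H} : V ∈ graphDomain A ↔ ∃ W, (V, W) ∈ A := by
  constructor
  · rintro ⟨⟨V', W⟩, h, rfl⟩; exact ⟨W, h⟩
  · rintro ⟨W, h⟩; exact ⟨(V, W), h, rfl⟩

/-- Density comes from surjectivity: if `Z` is orthogonal to the domain and `V + W = Z`, pairing
with `V` and skewness give `V = 0`, and then `single` gives `W = 0`. -/
theorem IsMaximalSkew.dense [CompleteSpace H] (hA : IsMaximalSkew A) :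
    Dense (graphDomain A : Set H) := by
  rw [Submodule.dense_iff_topologicalClosure_eq_top, Submodule.topologicalClosure_eq_top_iff,
    eq_bot_iff]
  intro Z hZ
  obtain ⟨V, W, h, hV⟩ := hA.range 1 one_pos Z
  have h1 : inner ℝ V Z = 0 := (Submodule.mem_orthogonal _ _).1 hZ V (mem_graphDomain.2 ⟨W, h⟩)
  rw [← hV, one_smul, inner_add_right, hA.skew V W h, add_zero, inner_self_eq_zero] at h1
  subst h1
  have := hA.single W h
  simp [← hV, this]

/-- The resolvent `(1 + (n+1)⁻¹A)⁻¹`. -/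
def IsMaximalSkew.resolvent (hA : IsMaximalSkew A) (n : ℕ) : H →L[ℝ] H :=
  LinearMap.mkContinuous
    { toFun := fun f => (hA.range ((n + 1 : ℝ)⁻¹) (by positivity) f).choose
      map_add' := by
        intro f g
        obtain ⟨W, h, e⟩ := (hA.range ((n + 1 : ℝ)⁻¹) (by positivity) f).choose_spec
        obtain ⟨W', h', e'⟩ := (hA.range ((n + 1 : ℝ)⁻¹) (by positivity) g).choose_spec
        obtain ⟨W'', h'', e''⟩ := (hA.range ((n + 1 : ℝ)⁻¹) (by positivity) (f + g)).choose_spec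
        refine hA.eq_of_add_eq h'' (A.add_mem h h') (ε := (n + 1 : ℝ)⁻¹) ?_
        rw [e'', smul_add, add_add_add_comm, e, e']
      map_smul' := by
        intro a f
        obtain ⟨W, h, e⟩ := (hA.range ((n + 1 : ℝ)⁻¹) (by positivity) f).choose_spec
        obtain ⟨W'', h'', e''⟩ := (hA.range ((n + 1 : ℝ)⁻¹) (by positivity) (a • f)).choose_spec
        refine hA.eq_of_add_eq h'' (A.smul_mem a h) (ε := (n + 1 : ℝ)⁻¹) ?_
        change _ = a • _ + _ • a • W
        rw [e'', smul_comm, ← smul_add, e] }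
    1 (by
      intro f
      obtain ⟨W, h, e⟩ := (hA.range ((n + 1 : ℝ)⁻¹) (by positivity) f).choose_spec
      have := hA.norm_le h ((n + 1 : ℝ)⁻¹)
      rw [e] at this
      simpa using this)

/-- The Yosida approximation `A (1 + (n+1)⁻¹A)⁻¹`. -/
def IsMaximalSkew.yosida (hA : IsMaximalSkew A) (n : ℕ) : H →L[ℝ] H :=
  (n + 1 : ℝ) • (ContinuousLinearMap.id ℝ H - hA.resolvent n)

theorem IsMaximalSkew.yosida_apply (hA : IsMaximalSkew A) (n : ℕ) (f : H) :
    hA.yosida n f = (n + 1 : ℝ) • (f - hA.resolvent n f) := rfl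

theorem IsMaximalSkew.resolvent_add (hA : IsMaximalSkew A) (n : ℕ) (f : H) :
    hA.resolvent n f + (n + 1 : ℝ)⁻¹ • hA.yosida n f = f := by
  rw [hA.yosida_apply, inv_smul_smul₀ (by positivity)]; abel

theorem IsMaximalSkew.resolvent_mem (hA : IsMaximalSkew A) (n : ℕ) (f : H) :
    (hA.resolvent n f, hA.yosida n f) ∈ A := by
  obtain ⟨W, h, e⟩ := (hA.range ((n + 1 : ℝ)⁻¹) (by positivity) f).choose_spec
  change hA.resolvent n f + _ = _ at e
  change (hA.resolvent n f, W) ∈ A at h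
  have : W = hA.yosida n f := by
    have h2 := hA.resolvent_add n f
    nth_rewrite 3 [← e] at h2
    rw [add_right_inj] at h2
    exact (smul_right_injective H (inv_ne_zero (by positivity : (n + 1 : ℝ) ≠ 0)) h2).symm
  exact this ▸ h

theorem IsMaximalSkew.resolvent_eq (hA : IsMaximalSkew A) (n : ℕ) {V W f : H} (h : (V, W) ∈ A)
    (e : V + (n + 1 : ℝ)⁻¹ • W = f) : hA.resolvent n f = V :=
  hA.eq_of_add_eq (hA.resolvent_mem n f) h (by rw [e, hA.resolvent_add])

theorem IsMaximalSkew.norm_resolvent_le (hA : IsMaximalSkew A) (n : ℕ) (f : H) :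
    ‖hA.resolvent n f‖ ≤ ‖f‖ := by
  have := hA.norm_le (hA.resolvent_mem n f) ((n + 1 : ℝ)⁻¹)
  rwa [hA.resolvent_add] at this

/-- The operator commutes with its resolvent. On the domain this bounds the Yosida approximations
uniformly in `n` and reduces their convergence to that of the resolvents. -/
theorem IsMaximalSkew.yosida_eq_resolvent (hA : IsMaximalSkew A) (n : ℕ) {V W : H}
    (h : (V, W) ∈ A) : hA.yosida n V = hA.resolvent n W := by
  have h1 := A.smul_mem (n + 1 : ℝ) (A.sub_mem h (hA.resolvent_mem n V))
  symm
  refine hA.resolvent_eq n (V := hA.yosida n V) (W := (n + 1 : ℝ) • (W - hA.yosida n V)) h1 ?_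
  rw [inv_smul_smul₀ (by positivity)]; abel

theorem IsMaximalSkew.commute_yosida (hA : IsMaximalSkew A) (n k : ℕ) :
    Commute (hA.yosida n) (hA.yosida k) := by
  have hJ : ∀ f, hA.resolvent n (hA.resolvent k f) = hA.resolvent k (hA.resolvent n f) := by
    intro f
    have h1 := hA.resolvent_mem k (hA.resolvent n f)
    rw [hA.yosida_eq_resolvent k (hA.resolvent_mem n f)] at h1
    refine hA.resolvent_eq n h1 ?_
    rw [← map_smul, ← map_add, hA.resolvent_add]
  ext f
  simp only [mul_apply_eq_comp, hA.yosida_apply, map_smul, map_sub, hJ, smul_sub]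
  rw [smul_comm (n + 1 : ℝ) (k + 1 : ℝ), smul_comm (n + 1 : ℝ) (k + 1 : ℝ),
    smul_comm (n + 1 : ℝ) (k + 1 : ℝ), smul_comm (n + 1 : ℝ) (k + 1 : ℝ)]
  abel

/-- The approximation need not be skew, but it is monotone: writing `f` as resolvent plus `(n+1)⁻¹`
times Yosida term, the first summand is orthogonal to the Yosida term. This makes the approximating
semigroups contractive. -/
theorem IsMaximalSkew.inner_yosida_nonneg (hA : IsMaximalSkew A) (n : ℕ) (f : H) :
    0 ≤ inner ℝ f (hA.yosida n f) := by
  have h := hA.skew _ _ (hA.resolvent_mem n f)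
  have h2 : inner ℝ f (hA.yosida n f) = (n + 1 : ℝ)⁻¹ * ‖hA.yosida n f‖ ^ 2 := by
    have h3 := congrArg (fun g => inner ℝ g (hA.yosida n f)) (hA.resolvent_add n f)
    rw [← h3, inner_add_left, h, real_inner_smul_left, real_inner_self_eq_norm_sq]
    ring
  rw [h2]; positivity

/-- Pointwise convergence of uniformly bounded operators extends from a dense set. -/
theorem tendsto_of_dense {ι : Type} {l : Filter ι} {S : Set H} (hS : Dense S) {M : ℝ}
    {F : ι → H →L[ℝ] H} {F' : H →L[ℝ] H} (hF : ∀ᶠ i in l, ∀ f, ‖F i f‖ ≤ M * ‖f‖)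
    (hF' : ∀ f, ‖F' f‖ ≤ M * ‖f‖) (h : ∀ g ∈ S, Tendsto (fun i => F i g) l (𝓝 (F' g))) (f : H) :
    Tendsto (fun i => F i f) l (𝓝 (F' f)) := by
  rw [Metric.tendsto_nhds]
  intro ε hε
  obtain ⟨δ, hδ, hδε⟩ : ∃ δ > 0, |M| * δ * 2 + δ < ε := by
    refine ⟨ε / (2 * (|M| * 2 + 1)), by positivity, ?_⟩
    have : |M| * (ε / (2 * (|M| * 2 + 1))) * 2 + ε / (2 * (|M| * 2 + 1)) = ε / 2 := by
      field_simp
    linarith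
  obtain ⟨g, hg, hd⟩ := Metric.dense_iff.1 hS f δ hδ
  filter_upwards [hF, Metric.tendsto_nhds.1 (h g hd) δ hδ] with i hi hi2
  have hfg : ‖f - g‖ ≤ δ := by
    rw [← dist_eq_norm, dist_comm]; exact (Metric.mem_ball.1 hg).le
  have hM : M * ‖f - g‖ ≤ |M| * δ :=
    mul_le_mul (le_abs_self M) hfg (norm_nonneg _) (abs_nonneg _)
  have h1 := (hi (f - g)).trans hM
  have h2 := (hF' (f - g)).trans hM
  rw [map_sub] at h1 h2
  rw [dist_eq_norm] at hi2 ⊢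
  have : F i f - F' f = (F i f - F i g) + (F i g - F' g) - (F' f - F' g) := by abel
  rw [this]
  calc _ ≤ ‖F i f - F i g‖ + ‖F i g - F' g‖ + ‖F' f - F' g‖ :=
        (norm_sub_le _ _).trans (add_le_add_left (norm_add_le _ _) _)
    _ < ε := by linarith

theorem cauchySeq_of_dense {S : Set H} (hS : Dense S) {F : ℕ → H →L[ℝ] H}
    (hF : ∀ i f, ‖F i f‖ ≤ ‖f‖) (h : ∀ g ∈ S, CauchySeq (fun i => F i g)) (f : H) :
    CauchySeq (fun i => F i f) := by
  rw [Metric.cauchySeq_iff']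
  intro ε hε
  obtain ⟨g, hg, hd⟩ := Metric.dense_iff.1 hS f (ε / 3) (by positivity)
  obtain ⟨N, hN⟩ := Metric.cauchySeq_iff'.1 (h g hd) (ε / 3) (by positivity)
  refine ⟨N, fun n hn => ?_⟩
  have hfg : ‖f - g‖ < ε / 3 := by
    rw [← dist_eq_norm, dist_comm]; exact Metric.mem_ball.1 hg
  have h1 := hF n (f - g)
  have h2 := hF N (f - g)
  have h3 := hN n hn
  rw [map_sub] at h1 h2
  rw [dist_eq_norm] at h3 ⊢
  have : F n f - F N f = (F n f - F n g) + (F n g - F N g) - (F N f - F N g) := by abel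
  rw [this]
  calc _ ≤ ‖F n f - F n g‖ + ‖F n g - F N g‖ + ‖F N f - F N g‖ :=
        (norm_sub_le _ _).trans (add_le_add_left (norm_add_le _ _) _)
    _ < ε := by linarith

/-- The semigroup generated by minus the Yosida approximation. -/
def IsMaximalSkew.approx (hA : IsMaximalSkew A) (n : ℕ) (t : ℝ) : H →L[ℝ] H :=
  NormedSpace.exp (t • (-hA.yosida n))

theorem IsMaximalSkew.approx_zero (hA : IsMaximalSkew A) (n : ℕ) (f : H) :
    hA.approx n 0 f = f := by
  simp [approx, NormedSpace.exp_zero]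

theorem IsMaximalSkew.commute_approx (hA : IsMaximalSkew A) (n k : ℕ) (t : ℝ) (f : H) :
    hA.yosida n (hA.approx k t f) = hA.approx k t (hA.yosida n f) := by
  have : Commute (hA.yosida n) (hA.approx k t) :=
    ((hA.commute_yosida n k).neg_right.smul_right t).exp_right
  exact DFunLike.congr_fun this.eq f

/-! ### Orbits of a C₀-semigroup starting in the domain of the generator -/

theorem IsGenerator.sub {G : ℝ → H →L[ℝ] H} {V W V' W' : H} (h : IsGenerator G V W)
    (h' : IsGenerator G V' W') : IsGenerator G (V - V') (W - W') := by
  refine (Tendsto.sub h h').congr fun t => ?_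
  rw [map_sub, ← smul_sub]; congr 1; abel

theorem IsC0Semigroup.tendsto_zero {G : ℝ → H →L[ℝ] H} (hG : IsC0Semigroup G) (V : H) :
    Tendsto (fun s => G s V) (𝓝[≥] 0) (𝓝 V) := by
  rw [← Ioi_insert, nhdsWithin_insert]
  refine Tendsto.sup ?_ (hG.tendsto V)
  have : G 0 V = V := by rw [hG.zero]; rfl
  nth_rewrite 2 [← this]
  exact tendsto_pure_nhds _ _

/-- The orbit of a point of the domain stays in the domain and solves the evolution equation. -/
theorem IsC0Semigroup.isGenerator_apply {G : ℝ → H →L[ℝ] H} (hG : IsC0Semigroup G) {V W : H}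
    (h : IsGenerator G V W) {t : ℝ} (ht : 0 ≤ t) : IsGenerator G (G t V) (G t W) := by
  refine (((G t).continuous.tendsto W).comp h).congr' ?_
  filter_upwards [self_mem_nhdsWithin] with s hs
  have h1 : G s (G t V) = G t (G s V) := by
    have h2 := hG.add s t (le_of_lt hs) ht
    rw [add_comm, hG.add t s ht (le_of_lt hs)] at h2
    exact (DFunLike.congr_fun h2 V).symm
  simp [h1]

theorem IsC0Semigroup.hasDerivWithinAt {G : ℝ → H →L[ℝ] H} (hG : IsC0Semigroup G) {V W : H}
    (h : IsGenerator G V W) {t : ℝ} (ht : 0 ≤ t) :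
    HasDerivWithinAt (fun t => G t V) (G t W) (Ici t) t := by
  rw [← hasDerivWithinAt_Ioi_iff_Ici, hasDerivWithinAt_iff_tendsto_slope' (by simp)]
  have h1 := hG.isGenerator_apply h ht
  have h2 : Tendsto (fun s => s - t) (𝓝[>] t) (𝓝[>] 0) := by
    refine tendsto_nhdsWithin_iff.2 ⟨?_, ?_⟩
    · have : Continuous (fun s : ℝ => s - t) := by fun_prop
      simpa using (this.tendsto t).mono_left (nhdsWithin_le_nhds (s := Ioi t))
    · filter_upwards [self_mem_nhdsWithin] with s hs
      exact mem_Ioi.2 (sub_pos.2 (mem_Ioi.1 hs))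
  refine (h1.comp h2).congr' ?_
  filter_upwards [self_mem_nhdsWithin] with s hs
  have hs' : t < s := hs
  have h3 := hG.add (s - t) t (sub_nonneg.2 hs'.le) ht
  rw [sub_add_cancel] at h3
  simp [slope_def_module, h3]

/-! ### Convergence of the Yosida approximations and the limiting semigroup -/

variable [CompleteSpace H]

theorem IsMaximalSkew.tendsto_resolvent (hA : IsMaximalSkew A) (f : H) :
    Tendsto (fun n => hA.resolvent n f) atTop (𝓝 f) := by
  refine tendsto_of_dense (M := 1) (F' := ContinuousLinearMap.id ℝ H) hA.dense
    (Eventually.of_forall fun n f => by simpa using hA.norm_resolvent_le n f)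
    (fun f => by simp) ?_ f
  intro V hV
  obtain ⟨W, h⟩ := mem_graphDomain.1 hV
  have hlim : Tendsto (fun n : ℕ => (n + 1 : ℝ)⁻¹ * ‖W‖) atTop (𝓝 0) := by
    have := (tendsto_one_div_add_atTop_nhds_zero_nat (𝕜 := ℝ)).mul_const ‖W‖
    simpa [one_div] using this
  rw [tendsto_iff_norm_sub_tendsto_zero]
  refine squeeze_zero (fun _ => norm_nonneg _) (fun n => ?_) hlim
  have h1 := hA.resolvent_add n V
  have h2 : hA.resolvent n V - V = -((n + 1 : ℝ)⁻¹ • hA.yosida n V) := by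
    nth_rewrite 2 [← h1]; abel
  rw [ContinuousLinearMap.id_apply, h2, norm_neg, norm_smul, hA.yosida_eq_resolvent n h,
    Real.norm_of_nonneg (by positivity)]
  gcongr
  exact hA.norm_resolvent_le n W

theorem IsMaximalSkew.approx_add (hA : IsMaximalSkew A) (n : ℕ) (s t : ℝ) (f : H) :
    hA.approx n (s + t) f = hA.approx n s (hA.approx n t f) := by
  let _ : NormedAlgebra ℚ (H →L[ℝ] H) := NormedAlgebra.restrictScalars ℚ ℝ _
  rw [approx, add_smul, NormedSpace.exp_add_of_commute
    (((Commute.refl _).smul_left s).smul_right t)]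
  rfl

theorem IsMaximalSkew.hasDerivAt_approx (hA : IsMaximalSkew A) (n : ℕ) (t : ℝ) :
    HasDerivAt (hA.approx n) (hA.approx n t * (-hA.yosida n)) t :=
  hasDerivAt_exp_smul_const (-hA.yosida n) t

theorem IsMaximalSkew.hasDerivAt_approx_apply (hA : IsMaximalSkew A) (n : ℕ) (t : ℝ) (f : H) :
    HasDerivAt (fun t => hA.approx n t f) (-hA.approx n t (hA.yosida n f)) t := by
  have := (hA.hasDerivAt_approx n t).clm_apply (hasDerivAt_const t f)
  simpa using this

theorem IsMaximalSkew.norm_approx_le (hA : IsMaximalSkew A) (n : ℕ) {t : ℝ} (ht : 0 ≤ t) (f : H) :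
    ‖hA.approx n t f‖ ≤ ‖f‖ := by
  have hd : ∀ s, HasDerivAt (fun s => ‖hA.approx n s f‖ ^ 2)
      (2 * inner ℝ (hA.approx n s f) (-hA.yosida n (hA.approx n s f))) s := by
    intro s
    have := (hA.hasDerivAt_approx_apply n s f).norm_sq
    rwa [← hA.commute_approx] at this
  have hanti : Antitone (fun s => ‖hA.approx n s f‖ ^ 2) := by
    refine antitone_of_deriv_nonpos (fun s => (hd s).differentiableAt) fun s => ?_
    rw [(hd s).deriv, inner_neg_right]
    linarith [hA.inner_yosida_nonneg n (hA.approx n s f)]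
  have := hanti ht
  simp only [hA.approx_zero] at this
  exact le_of_sq_le_sq this (norm_nonneg _)

/-- The curve `s ↦ exp(-sAₙ) exp(-(t-s)Aₖ) f` joins the two values. As everything commutes, its
derivative is a product of contractions applied to `(Aₖ - Aₙ) f`. -/
theorem IsMaximalSkew.norm_approx_sub_le (hA : IsMaximalSkew A) (n k : ℕ) {t : ℝ} (ht : 0 ≤ t)
    (f : H) : ‖hA.approx n t f - hA.approx k t f‖ ≤ ‖hA.yosida n f - hA.yosida k f‖ * t := by
  have hd : ∀ s, HasDerivAt (fun s => hA.approx n s (hA.approx k (t - s) f))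
      (hA.approx n s (hA.approx k (t - s) (hA.yosida k f - hA.yosida n f))) s := by
    intro s
    have h1 : HasDerivAt (fun s => hA.approx k (t - s) f) (hA.approx k (t - s) (hA.yosida k f)) s := by
      have := (hA.hasDerivAt_approx_apply k (t - s) f).scomp s ((hasDerivAt_id s).const_sub t)
      simpa [Function.comp_def] using this
    convert (hA.hasDerivAt_approx n s).clm_apply h1 using 1
    simp only [mul_apply_eq_comp, neg_apply, map_sub, map_neg,
      hA.commute_approx]
    abel
  have := norm_image_sub_le_of_norm_deriv_le_segment' (a := 0) (b := t)
    (C := ‖hA.yosida n f - hA.yosida k f‖) (fun s _ => (hd s).hasDerivWithinAt) (fun s hs => ?_) t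
    ⟨ht, le_rfl⟩
  · simpa [hA.approx_zero] using this
  · rw [norm_sub_rev]
    exact (hA.norm_approx_le n hs.1 _).trans (hA.norm_approx_le k (by linarith [hs.2]) _)

theorem IsMaximalSkew.tendsto_yosida (hA : IsMaximalSkew A) {V W : H} (h : (V, W) ∈ A) :
    Tendsto (fun n => hA.yosida n V) atTop (𝓝 W) := by
  simp_rw [hA.yosida_eq_resolvent _ h]
  exact hA.tendsto_resolvent W

theorem IsMaximalSkew.cauchySeq_approx (hA : IsMaximalSkew A) {t : ℝ} (ht : 0 ≤ t) (f : H) :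
    CauchySeq (fun n => hA.approx n t f) := by
  refine cauchySeq_of_dense hA.dense (fun n f => hA.norm_approx_le n ht f) (fun V hV => ?_) f
  obtain ⟨W, h⟩ := mem_graphDomain.1 hV
  have hc := (hA.tendsto_yosida h).cauchySeq
  rw [Metric.cauchySeq_iff'] at hc ⊢
  intro ε hε
  obtain ⟨N, hN⟩ := hc (ε / (t + 1)) (by positivity)
  refine ⟨N, fun n hn => ?_⟩
  have h1 := hN n hn
  rw [dist_eq_norm] at h1 ⊢
  rw [lt_div_iff₀ (by positivity)] at h1
  have := hA.norm_approx_sub_le n N ht V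
  nlinarith [norm_nonneg (hA.yosida n V - hA.yosida N V)]

/-- The semigroup generated by minus the operator with graph `A`, extended to negative times by
the identity. -/
def IsMaximalSkew.semigroup (hA : IsMaximalSkew A) (t : ℝ) : H →L[ℝ] H :=
  continuousLinearMapOfTendsto (l := atTop) (fun n => hA.approx n (max t 0))
    (f := fun f =>
      (cauchySeq_tendsto_of_complete (hA.cauchySeq_approx (le_max_right t 0) f)).choose)
    (tendsto_pi_nhds.2 fun f =>
      (cauchySeq_tendsto_of_complete (hA.cauchySeq_approx (le_max_right t 0) f)).choose_spec)

theorem IsMaximalSkew.tendsto_approx_max (hA : IsMaximalSkew A) (t : ℝ) (f : H) :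
    Tendsto (fun n => hA.approx n (max t 0) f) atTop (𝓝 (hA.semigroup t f)) :=
  (cauchySeq_tendsto_of_complete (hA.cauchySeq_approx (le_max_right t 0) f)).choose_spec

theorem IsMaximalSkew.tendsto_approx (hA : IsMaximalSkew A) {t : ℝ} (ht : 0 ≤ t) (f : H) :
    Tendsto (fun n => hA.approx n t f) atTop (𝓝 (hA.semigroup t f)) := by
  simpa [max_eq_left ht] using hA.tendsto_approx_max t f

theorem IsMaximalSkew.norm_semigroup_le (hA : IsMaximalSkew A) (t : ℝ) (f : H) :
    ‖hA.semigroup t f‖ ≤ ‖f‖ :=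
  le_of_tendsto (hA.tendsto_approx_max t f).norm
    (Eventually.of_forall fun n => hA.norm_approx_le n (le_max_right t 0) f)

theorem IsMaximalSkew.semigroup_of_nonpos (hA : IsMaximalSkew A) {t : ℝ} (ht : t ≤ 0) (f : H) :
    hA.semigroup t f = f := by
  refine tendsto_nhds_unique (hA.tendsto_approx_max t f) ?_
  simp [max_eq_right ht, hA.approx_zero]

theorem IsMaximalSkew.semigroup_add (hA : IsMaximalSkew A) {s t : ℝ} (hs : 0 ≤ s) (ht : 0 ≤ t)
    (f : H) : hA.semigroup (s + t) f = hA.semigroup s (hA.semigroup t f) := by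
  refine tendsto_nhds_unique (hA.tendsto_approx (add_nonneg hs ht) f) ?_
  simp_rw [hA.approx_add]
  have h1 := hA.tendsto_approx hs (hA.semigroup t f)
  have h2 : Tendsto (fun n => hA.approx n s (hA.approx n t f - hA.semigroup t f)) atTop (𝓝 0) := by
    refine squeeze_zero_norm (fun n => hA.norm_approx_le n hs _) ?_
    exact tendsto_iff_norm_sub_tendsto_zero.1 (hA.tendsto_approx ht f)
  simpa using h1.add h2

theorem IsMaximalSkew.norm_semigroup_sub_le (hA : IsMaximalSkew A) {t : ℝ} (ht : 0 ≤ t) {V W : H}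
    (h : (V, W) ∈ A) : ‖hA.semigroup t V - V‖ ≤ ‖W‖ * t := by
  refine le_of_tendsto ((hA.tendsto_approx ht V).sub_const V).norm (Eventually.of_forall fun n => ?_)
  have := norm_image_sub_le_of_norm_deriv_le_segment' (a := 0) (b := t) (C := ‖W‖)
    (fun s _ => (hA.hasDerivAt_approx_apply n s V).hasDerivWithinAt) (fun s hs => ?_) t
    ⟨ht, le_rfl⟩
  · simpa [hA.approx_zero] using this
  · rw [norm_neg, hA.yosida_eq_resolvent n h]
    exact (hA.norm_approx_le n hs.1 _).trans (hA.norm_resolvent_le n _)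

theorem IsMaximalSkew.tendsto_semigroup_zero (hA : IsMaximalSkew A) (f : H) :
    Tendsto (fun t => hA.semigroup t f) (𝓝[≥] 0) (𝓝 f) := by
  refine tendsto_of_dense (M := 1) (F' := ContinuousLinearMap.id ℝ H) hA.dense
    (Eventually.of_forall fun t f => by simpa using hA.norm_semigroup_le t f)
    (fun f => by simp) ?_ f
  intro V hV
  obtain ⟨W, h⟩ := mem_graphDomain.1 hV
  rw [tendsto_iff_norm_sub_tendsto_zero]
  have hlim : Tendsto (fun t : ℝ => ‖W‖ * t) (𝓝[≥] 0) (𝓝 0) := by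
    have : Tendsto (fun t : ℝ => ‖W‖ * t) (𝓝 0) (𝓝 (‖W‖ * 0)) :=
      (continuous_const.mul continuous_id).tendsto 0
    rw [mul_zero] at this
    exact this.mono_left nhdsWithin_le_nhds
  refine squeeze_zero' (Eventually.of_forall fun _ => norm_nonneg _) ?_ hlim
  filter_upwards [self_mem_nhdsWithin] with t ht
  exact hA.norm_semigroup_sub_le ht h

theorem IsMaximalSkew.norm_semigroup_sub_semigroup_le (hA : IsMaximalSkew A) {s t : ℝ} (hs : 0 ≤ s)
    (ht : 0 ≤ t) (f : H) :
    ‖hA.semigroup t f - hA.semigroup s f‖ ≤ ‖hA.semigroup |t - s| f - f‖ := by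
  wlog hst : s ≤ t generalizing s t
  · rw [norm_sub_rev, abs_sub_comm]; exact this ht hs (le_of_not_ge hst)
  rw [abs_of_nonneg (sub_nonneg.2 hst)]
  have := hA.semigroup_add hs (sub_nonneg.2 hst) f
  rw [add_sub_cancel] at this
  rw [this, ← map_sub]
  exact hA.norm_semigroup_le _ _

theorem IsMaximalSkew.semigroup_max (hA : IsMaximalSkew A) (t : ℝ) (f : H) :
    hA.semigroup (max t 0) f = hA.semigroup t f := by
  rcases le_total t 0 with h | h
  · rw [max_eq_right h, hA.semigroup_of_nonpos le_rfl, hA.semigroup_of_nonpos h]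
  · rw [max_eq_left h]

theorem IsMaximalSkew.continuous_semigroup (hA : IsMaximalSkew A) (f : H) :
    Continuous (fun t => hA.semigroup t f) := by
  rw [continuous_iff_continuousAt]
  intro s
  rw [ContinuousAt, tendsto_iff_norm_sub_tendsto_zero]
  have h1 : Tendsto (fun t : ℝ => |max t 0 - max s 0|) (𝓝 s) (𝓝[≥] 0) := by
    refine tendsto_nhdsWithin_iff.2 ⟨?_, Eventually.of_forall fun t => mem_Ici.2 (abs_nonneg _)⟩
    have : Continuous (fun t : ℝ => |max t 0 - max s 0|) := by fun_prop
    simpa using this.tendsto s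
  have h2 := tendsto_iff_norm_sub_tendsto_zero.1 ((hA.tendsto_semigroup_zero f).comp h1)
  refine squeeze_zero (fun _ => norm_nonneg _) (fun t => ?_) h2
  rw [← hA.semigroup_max t, ← hA.semigroup_max s]
  exact hA.norm_semigroup_sub_semigroup_le (le_max_right _ _) (le_max_right _ _) f

theorem IsMaximalSkew.isC0Semigroup (hA : IsMaximalSkew A) : IsC0Semigroup hA.semigroup where
  zero := by ext f; exact hA.semigroup_of_nonpos le_rfl f
  add s t hs ht := by ext f; exact hA.semigroup_add hs ht f
  tendsto V := (hA.tendsto_semigroup_zero V).mono_left (nhdsWithin_mono _ Ioi_subset_Ici_self)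

/-- The integrated evolution equation holds for each approximation and passes to the limit by
dominated convergence, with `‖W‖` as dominating constant. -/
theorem IsMaximalSkew.semigroup_eq_sub_integral (hA : IsMaximalSkew A) {t : ℝ} (ht : 0 ≤ t)
    {V W : H} (h : (V, W) ∈ A) :
    hA.semigroup t V = V - ∫ s in (0 : ℝ)..t, hA.semigroup s W := by
  have hc : ∀ n f, Continuous (fun s => hA.approx n s f) := fun n f =>
    continuous_iff_continuousAt.2 fun s => (hA.hasDerivAt_approx_apply n s f).continuousAt
  have h1 : ∀ n, hA.approx n t V = V - ∫ s in (0 : ℝ)..t, hA.approx n s (hA.yosida n V) := by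
    intro n
    have := intervalIntegral.integral_eq_sub_of_hasDerivAt (a := 0) (b := t)
      (fun s _ => hA.hasDerivAt_approx_apply n s V) ((hc n _).neg.intervalIntegrable _ _)
    rw [intervalIntegral.integral_neg, hA.approx_zero] at this
    rw [sub_eq_add_neg, this]; abel
  refine tendsto_nhds_unique (hA.tendsto_approx ht V) ?_
  simp_rw [h1]
  refine tendsto_const_nhds.sub ?_
  refine intervalIntegral.tendsto_integral_filter_of_dominated_convergence (fun _ => ‖W‖)
    (Eventually.of_forall fun n => (hc n _).aestronglyMeasurable)
    (Eventually.of_forall fun n => Eventually.of_forall fun s hs => ?_)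
    intervalIntegrable_const (Eventually.of_forall fun s hs => ?_)
  · rw [uIoc_of_le ht] at hs
    rw [hA.yosida_eq_resolvent n h]
    exact (hA.norm_approx_le n hs.1.le _).trans (hA.norm_resolvent_le n _)
  · rw [uIoc_of_le ht] at hs
    have h2 : Tendsto (fun n => hA.approx n s (hA.yosida n V - W)) atTop (𝓝 0) := by
      refine squeeze_zero_norm (fun n => hA.norm_approx_le n hs.1.le _) ?_
      exact tendsto_iff_norm_sub_tendsto_zero.1 (hA.tendsto_yosida h)
    simpa using (hA.tendsto_approx hs.1.le W).add h2

theorem IsMaximalSkew.isGenerator_of_mem (hA : IsMaximalSkew A) {V W : H} (h : (V, W) ∈ A) :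
    IsGenerator hA.semigroup V (-W) := by
  have h1 : HasDerivAt (fun t => ∫ s in (0 : ℝ)..t, hA.semigroup s W) (hA.semigroup 0 W) 0 :=
    intervalIntegral.integral_hasDerivAt_right
      ((hA.continuous_semigroup W).intervalIntegrable _ _)
      ((hA.continuous_semigroup W).stronglyMeasurableAtFilter _ _)
      (hA.continuous_semigroup W).continuousAt
  rw [hA.semigroup_of_nonpos le_rfl] at h1
  have h2 := (hasDerivWithinAt_iff_tendsto_slope' (s := Ioi (0 : ℝ)) (by simp)).1
    h1.neg.hasDerivWithinAt
  refine h2.congr' ?_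
  filter_upwards [self_mem_nhdsWithin] with t ht
  simp [slope_def_module, hA.semigroup_eq_sub_integral (le_of_lt ht) h]

theorem IsMaximalSkew.isGenerator_iff (hA : IsMaximalSkew A) (V W : H) :
    IsGenerator hA.semigroup V W ↔ (V, -W) ∈ A := by
  refine ⟨fun h => ?_, fun h => by simpa using hA.isGenerator_of_mem h⟩
  obtain ⟨V₁, W₁, h₁, e⟩ := hA.range 1 one_pos (V - W)
  rw [one_smul] at e
  have hg := h.sub (hA.isGenerator_of_mem h₁)
  have he : W - -W₁ = V - V₁ := by
    rw [sub_neg_eq_add, ← sub_eq_zero]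
    have := sub_eq_zero.2 e
    rw [← this]; abel
  rw [he] at hg
  -- Difference quotients of a contraction semigroup have nonpositive inner product with the
  -- starting vector; here they tend to that vector itself.
  have hle : inner ℝ (V - V₁) (V - V₁) ≤ 0 := by
    refine le_of_tendsto ((continuous_const.inner continuous_id).tendsto (V - V₁) |>.comp hg) ?_
    filter_upwards [self_mem_nhdsWithin] with t ht
    have ht' : 0 < t := ht
    simp only [Function.comp_apply, id, real_inner_smul_right, inner_sub_right]
    have h2 := real_inner_le_norm (V - V₁) (hA.semigroup t (V - V₁))
    have h3 := hA.norm_semigroup_le t (V - V₁)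
    have h4 : inner ℝ (V - V₁) (V - V₁) = ‖V - V₁‖ * ‖V - V₁‖ := real_inner_self_eq_norm_mul_norm _
    rw [inner_sub_right (V - V₁) V V₁] at h4
    refine mul_nonpos_of_nonneg_of_nonpos (by positivity) ?_
    rw [h4]
    nlinarith [norm_nonneg (V - V₁)]
  have hz : V - V₁ = 0 := inner_self_eq_zero.1 (le_antisymm hle real_inner_self_nonneg)
  have hW : -W = W₁ := by
    rw [hz] at he
    rw [sub_neg_eq_add] at he
    exact neg_eq_of_add_eq_zero_right he
  rw [sub_eq_zero.1 hz, hW]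
  exact h₁

/-! ### Local boundedness, strong continuity and uniqueness of C₀-semigroups -/

/-- Otherwise there are times `tₙ → 0` with operator norms above `n`, although every orbit converges
along `tₙ`; this contradicts the uniform boundedness principle. -/
theorem IsC0Semigroup.bounded_near_zero {G : ℝ → H →L[ℝ] H} (hG : IsC0Semigroup G) :
    ∃ δ > 0, ∃ M, ∀ t ∈ Icc 0 δ, ‖G t‖ ≤ M := by
  by_contra! hcon
  choose t ht hM using fun n : ℕ => hcon ((n + 1 : ℝ)⁻¹) (by positivity) n
  have ht0 : Tendsto t atTop (𝓝 0) := by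
    refine squeeze_zero (fun n => (ht n).1) (fun n => (ht n).2) ?_
    simpa [one_div] using tendsto_one_div_add_atTop_nhds_zero_nat (𝕜 := ℝ)
  have : ∀ V, ∃ C, ∀ n, ‖G (t n) V‖ ≤ C := by
    intro V
    have h1 : Tendsto (fun n => G (t n) V) atTop (𝓝 V) :=
      (hG.tendsto_zero V).comp (tendsto_nhdsWithin_iff.2 ⟨ht0, Eventually.of_forall fun n => (ht n).1⟩)
    obtain ⟨C, hC⟩ := h1.norm.bddAbove_range
    exact ⟨C, fun n => hC ⟨n, rfl⟩⟩
  obtain ⟨C, hC⟩ := banach_steinhaus this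
  obtain ⟨n, hn⟩ := exists_nat_gt C
  linarith [hC n, hM n]

theorem IsC0Semigroup.bounded {G : ℝ → H →L[ℝ] H} (hG : IsC0Semigroup G) (b : ℝ) :
    ∃ M, ∀ t ∈ Icc 0 b, ‖G t‖ ≤ M := by
  obtain ⟨δ, hδ, M, hM⟩ := hG.bounded_near_zero
  have : ∀ n : ℕ, ∃ M, ∀ t ∈ Icc 0 (n * δ), ‖G t‖ ≤ M := by
    intro n
    induction n with
    | zero => exact ⟨M, fun t ht => hM t ⟨ht.1, by have := ht.2; simp at this; linarith⟩⟩
    | succ n ih =>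
      obtain ⟨N, hN⟩ := ih
      refine ⟨max M (M * N), fun t ht => ?_⟩
      rcases le_total t δ with h | h
      · exact (hM t ⟨ht.1, h⟩).trans (le_max_left _ _)
      · have h1 : t = δ + (t - δ) := by ring
        have h2 := ht.2
        push_cast at h2
        have hm := hM δ ⟨hδ.le, le_rfl⟩
        rw [h1, hG.add _ _ hδ.le (by linarith)]
        refine ((ContinuousLinearMap.opNorm_comp_le _ _).trans ?_).trans (le_max_right _ _)
        exact mul_le_mul hm (hN _ ⟨by linarith, by linarith⟩) (norm_nonneg _)
          ((norm_nonneg _).trans hm)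
  obtain ⟨n, hn⟩ := exists_nat_gt (b / δ)
  obtain ⟨M, hM⟩ := this n
  rw [div_lt_iff₀ hδ] at hn
  exact ⟨M, fun t ht => hM t ⟨ht.1, ht.2.trans hn.le⟩⟩

theorem IsC0Semigroup.continuousOn {G : ℝ → H →L[ℝ] H} (hG : IsC0Semigroup G) (b : ℝ) (V : H) :
    ContinuousOn (fun t => G t V) (Icc 0 b) := by
  obtain ⟨M, hM⟩ := hG.bounded b
  have key : ∀ s t, 0 ≤ s → s ≤ t → s ≤ b → ‖G t V - G s V‖ ≤ M * ‖G (t - s) V - V‖ := by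
    intro s t hs hst hsb
    have h1 := hG.add s (t - s) hs (sub_nonneg.2 hst)
    rw [add_sub_cancel] at h1
    rw [h1, ContinuousLinearMap.comp_apply, ← map_sub]
    exact (ContinuousLinearMap.le_opNorm _ _).trans
      (mul_le_mul_of_nonneg_right (hM s ⟨hs, hsb⟩) (norm_nonneg _))
  have key' : ∀ s ∈ Icc 0 b, ∀ t ∈ Icc 0 b, ‖G t V - G s V‖ ≤ M * ‖G |t - s| V - V‖ := by
    intro s hs t ht
    rcases le_total s t with h | h
    · rw [abs_of_nonneg (sub_nonneg.2 h)]; exact key s t hs.1 h hs.2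
    · rw [norm_sub_rev, abs_sub_comm, abs_of_nonneg (sub_nonneg.2 h)]; exact key t s ht.1 h ht.2
  intro s hs
  rw [ContinuousWithinAt, tendsto_iff_norm_sub_tendsto_zero]
  have h1 : Tendsto (fun t : ℝ => |t - s|) (𝓝[Icc 0 b] s) (𝓝[≥] 0) := by
    refine tendsto_nhdsWithin_iff.2 ⟨?_, Eventually.of_forall fun t => mem_Ici.2 (abs_nonneg _)⟩
    have : Continuous (fun t : ℝ => |t - s|) := by fun_prop
    simpa using (this.tendsto s).mono_left (nhdsWithin_le_nhds (s := Icc 0 b))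
  have h2 := (tendsto_iff_norm_sub_tendsto_zero.1 ((hG.tendsto_zero V).comp h1)).const_mul M
  rw [mul_zero] at h2
  refine squeeze_zero' (Eventually.of_forall fun _ => norm_nonneg _) ?_ h2
  filter_upwards [self_mem_nhdsWithin] with t ht
  exact key' s hs t ht

/-- A `C₀`-semigroup is determined by its generator. -/
theorem IsMaximalSkew.eq_semigroup (hA : IsMaximalSkew A) {G : ℝ → H →L[ℝ] H}
    (hG : IsC0Semigroup G) (hgen : ∀ V W, IsGenerator G V W ↔ (V, -W) ∈ A) {t : ℝ} (ht : 0 ≤ t) :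
    G t = hA.semigroup t := by
  refine ContinuousLinearMap.ext_on (s := (graphDomain A : Set H))
    (by rw [Submodule.span_eq]; exact hA.dense) fun V hV => ?_
  obtain ⟨W, h⟩ := mem_graphDomain.1 hV
  have hS := hA.isC0Semigroup
  have h1 : IsGenerator G V (-W) := (hgen _ _).2 (by simpa using h)
  have h2 := hA.isGenerator_of_mem h
  -- Both orbits stay in the domain, so the squared norm of their difference has right derivative
  -- zero by skewness. Continuity and right derivatives suffice for it to be constant.
  have hcont : ContinuousOn (fun s => ‖G s V - hA.semigroup s V‖ ^ 2) (Icc 0 t) :=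
    (((hG.continuousOn t V).sub (hS.continuousOn t V)).norm).pow 2
  have hz := constant_of_has_deriv_right_zero hcont (fun s hs => ?_) t ⟨ht, le_rfl⟩
  · simp only [hG.zero, hS.zero, sub_self, norm_zero] at hz
    have : ‖G t V - hA.semigroup t V‖ = 0 := by
      simpa using hz
    exact sub_eq_zero.1 (norm_eq_zero.1 this)
  · have h3 : HasDerivWithinAt (fun s => ‖G s V - hA.semigroup s V‖ ^ 2)
        (2 * inner ℝ (G s V - hA.semigroup s V) (G s (-W) - hA.semigroup s (-W))) (Ici s) s :=
      ((hG.hasDerivWithinAt h1 hs.1).sub (hS.hasDerivWithinAt h2 hs.1)).norm_sq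
    have h4 := (hgen _ _).1 (hG.isGenerator_apply h1 hs.1)
    have h5 := (hA.isGenerator_iff _ _).1 (hS.isGenerator_apply h2 hs.1)
    have h6 := hA.skew _ _ (A.sub_mem h4 h5)
    have h7 : G s (-W) - hA.semigroup s (-W) = -(-G s (-W) - -hA.semigroup s (-W)) := by abel
    rw [h7, inner_neg_right, h6, neg_zero, mul_zero] at h3
    exact h3

end Semigroup

/-! ### Test functions -/

variable {Ω : Set R3}

theorem IsTest.memLp {F : Type} [NormedAddCommGroup F] [NormedSpace ℝ F] {ψ : R3 → F}
    (h : IsTest Ω ψ) : MemLp ψ 2 (vol Ω) :=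
  (h.1.continuous.memLp_of_hasCompactSupport h.2.1).restrict Ω

theorem IsTest.eq_zero_of_notMem {F : Type} [NormedAddCommGroup F] [NormedSpace ℝ F] {ψ : R3 → F}
    (h : IsTest Ω ψ) {x : R3} (hx : x ∉ Ω) : ψ x = 0 :=
  image_eq_zero_of_notMem_tsupport fun hm => hx (h.2.2 hm)

theorem hasFDerivAt_apply {ψ : R3 → R3} (hψ : ContDiff ℝ ∞ ψ) (k : Fin 3) (x : R3) :
    HasFDerivAt (fun x => ψ x k) ((EuclideanSpace.proj k : R3 →L[ℝ] ℝ).comp (fderiv ℝ ψ x)) x :=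
  (EuclideanSpace.proj k : R3 →L[ℝ] ℝ).hasFDerivAt.comp x
    (hψ.differentiable (by simp) x).hasFDerivAt

theorem partialD_eq {ψ : R3 → R3} (hψ : ContDiff ℝ ∞ ψ) (i k : Fin 3) (x : R3) :
    partialD ψ i k x = fderiv ℝ (fun x => ψ x k) x (EuclideanSpace.single i 1) := by
  rw [(hasFDerivAt_apply hψ k x).fderiv]; rfl

theorem continuous_partialD {ψ : R3 → R3} (hψ : ContDiff ℝ ∞ ψ) (i k : Fin 3) :
    Continuous (partialD ψ i k) := by
  have h1 : Continuous (fun x => fderiv ℝ ψ x (EuclideanSpace.single i 1)) :=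
    (hψ.continuous_fderiv (by simp)).clm_apply continuous_const
  exact (EuclideanSpace.proj k : R3 →L[ℝ] ℝ).continuous.comp h1

theorem continuous_curl {ψ : R3 → R3} (hψ : ContDiff ℝ ∞ ψ) : Continuous (curl ψ) := by
  unfold curl
  refine (PiLp.continuous_toLp 2 _).comp (continuous_pi fun i => ?_)
  fin_cases i
  · exact (continuous_partialD hψ _ _).sub (continuous_partialD hψ _ _)
  · exact (continuous_partialD hψ _ _).sub (continuous_partialD hψ _ _)
  · exact (continuous_partialD hψ _ _).sub (continuous_partialD hψ _ _)

theorem curl_eq_zero {ψ : R3 → R3} {x : R3} (hx : x ∉ tsupport ψ) : curl ψ x = 0 := by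
  have h : fderiv ℝ ψ x = 0 := by
    by_contra h
    exact hx (support_fderiv_subset ℝ h)
  ext i
  fin_cases i <;> simp [curl, partialD, h]

theorem memLp_curl {ψ : R3 → R3} (h : IsTest Ω ψ) : MemLp (curl ψ) 2 (vol Ω) :=
  ((continuous_curl h.1).memLp_of_hasCompactSupport
    (HasCompactSupport.intro h.2.1 fun _ hx => curl_eq_zero hx)).restrict Ω

theorem integrable_apply_mul_partialD {ψ χ : R3 → R3} (hψ : IsTest Ω ψ) (hχ : IsTest Ω χ)
    (k i j : Fin 3) : Integrable (fun x => ψ x k * partialD χ i j x) := by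
  refine Continuous.integrable_of_hasCompactSupport ?_ ?_
  · exact ((EuclideanSpace.proj k : R3 →L[ℝ] ℝ).continuous.comp hψ.1.continuous).mul
      (continuous_partialD hχ.1 i j)
  · refine HasCompactSupport.intro hψ.2.1 fun x hx => ?_
    rw [image_eq_zero_of_notMem_tsupport hx]; simp

/-- Integration by parts in direction `i`, kept componentwise so that the symmetry of the curl
becomes a rearrangement of six terms. -/
theorem integral_apply_mul_partialD {ψ χ : R3 → R3} (hψ : IsTest Ω ψ) (hχ : IsTest Ω χ)
    (k i j : Fin 3) :
    ∫ x, ψ x k * partialD χ i j x = -∫ x, χ x j * partialD ψ i k x := by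
  have h1 := integrable_apply_mul_partialD hψ hχ k i j
  have h2 := integrable_apply_mul_partialD hχ hψ j i k
  simp_rw [partialD_eq hψ.1] at h2 ⊢
  simp_rw [partialD_eq hχ.1] at h1 ⊢
  simp_rw [mul_comm (χ _ j)] at h2 ⊢
  refine integral_mul_fderiv_eq_neg_fderiv_mul_of_integrable h2 h1 ?_
    (fun x _ => (hasFDerivAt_apply hψ.1 k x).differentiableAt)
    (fun x _ => (hasFDerivAt_apply hχ.1 j x).differentiableAt)
  refine Continuous.integrable_of_hasCompactSupport ?_ ?_
  · exact ((EuclideanSpace.proj k : R3 →L[ℝ] ℝ).continuous.comp hψ.1.continuous).mul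
      ((EuclideanSpace.proj j : R3 →L[ℝ] ℝ).continuous.comp hχ.1.continuous)
  · refine HasCompactSupport.intro hψ.2.1 fun x hx => ?_
    rw [image_eq_zero_of_notMem_tsupport hx]; simp

theorem integral_inner_curl {ψ χ : R3 → R3} (hψ : IsTest Ω ψ) (hχ : IsTest Ω χ) :
    ∫ x, inner ℝ (ψ x) (curl χ x) =
      ((∫ x, ψ x 0 * partialD χ 1 2 x) - ∫ x, ψ x 0 * partialD χ 2 1 x) +
      ((∫ x, ψ x 1 * partialD χ 2 0 x) - ∫ x, ψ x 1 * partialD χ 0 2 x) +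
      ((∫ x, ψ x 2 * partialD χ 0 1 x) - ∫ x, ψ x 2 * partialD χ 1 0 x) := by
  have hi := integrable_apply_mul_partialD hψ hχ
  have he : ∀ x, inner ℝ (ψ x) (curl χ x) =
      ((ψ x 0 * partialD χ 1 2 x - ψ x 0 * partialD χ 2 1 x) +
      (ψ x 1 * partialD χ 2 0 x - ψ x 1 * partialD χ 0 2 x)) +
      (ψ x 2 * partialD χ 0 1 x - ψ x 2 * partialD χ 1 0 x) := by
    intro x
    simp only [PiLp.inner_apply, Fin.sum_univ_three, curl, RCLike.inner_apply, conj_trivial]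
    simp
    ring
  simp_rw [he]
  rw [integral_add, integral_add, integral_sub (hi _ _ _) (hi _ _ _),
    integral_sub (hi _ _ _) (hi _ _ _), integral_sub (hi _ _ _) (hi _ _ _)]
  · exact (hi _ _ _).sub (hi _ _ _)
  · exact (hi _ _ _).sub (hi _ _ _)
  · exact ((hi _ _ _).sub (hi _ _ _)).add ((hi _ _ _).sub (hi _ _ _))
  · exact (hi _ _ _).sub (hi _ _ _)

/-- The curl is symmetric on test fields. -/
theorem integral_inner_curl_comm {ψ χ : R3 → R3} (hψ : IsTest Ω ψ) (hχ : IsTest Ω χ) :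
    ∫ x, inner ℝ (ψ x) (curl χ x) ∂(vol Ω) = ∫ x, inner ℝ (curl ψ x) (χ x) ∂(vol Ω) := by
  rw [setIntegral_eq_integral_of_forall_compl_eq_zero fun x hx => by
      rw [hψ.eq_zero_of_notMem hx, inner_zero_left],
    setIntegral_eq_integral_of_forall_compl_eq_zero fun x hx => by
      rw [hχ.eq_zero_of_notMem hx, inner_zero_right]]
  simp_rw [real_inner_comm (χ _)]
  rw [integral_inner_curl hψ hχ, integral_inner_curl hχ hψ]
  simp only [integral_apply_mul_partialD hψ hχ]
  ring

/-- A square integrable function whose integral against every scalar test function vanishes is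
zero. -/
theorem ae_eq_zero_of_integral_smul {F : Type} [NormedAddCommGroup F] [NormedSpace ℝ F]
    [CompleteSpace F] (hΩ : IsOpen Ω) (hb : Bornology.IsBounded Ω) (V : Lp F 2 (vol Ω))
    (h : ∀ g : R3 → ℝ, IsTest Ω g → ∫ x, g x • V x ∂(vol Ω) = 0) : V = 0 := by
  have : IsFiniteMeasure (vol Ω) := ⟨by simpa using hb.measure_lt_top⟩
  have hi : Integrable V (vol Ω) := (Lp.memLp V).integrable (by norm_num)
  have h1 := hΩ.ae_eq_zero_of_integral_contDiff_smul_eq_zero (μ := vol Ω) (f := V)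
    (hi.locallyIntegrable.locallyIntegrableOn _) fun g hg hc hs => h g ⟨hg, hc, hs⟩
  rw [Lp.eq_zero_iff_ae_eq_zero]
  filter_upwards [h1, ae_restrict_mem hΩ.measurableSet] with x hx hx'
  exact hx hx'

theorem IsTest.smul_const {g : R3 → ℝ} (hg : IsTest Ω g) {F : Type} [NormedAddCommGroup F]
    [NormedSpace ℝ F] (a : F) : IsTest Ω (fun x => g x • a) :=
  ⟨hg.1.smul contDiff_const, hg.2.1.smul_right, (closure_mono (by
    intro x hx h; exact hx (by simp [h]))).trans hg.2.2⟩

theorem eq_zero_of_integral_inner_test (hΩ : IsOpen Ω) (hb : Bornology.IsBounded Ω) (V : X Ω)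
    (h : ∀ ψ : R3 → R3, IsTest Ω ψ → ∫ x, inner ℝ (V x) (ψ x) ∂(vol Ω) = 0) : V = 0 := by
  refine ae_eq_zero_of_integral_smul hΩ hb V fun g hg => ?_
  have hi : Integrable (fun x => g x • V x) (vol Ω) := memLp_one_iff_integrable.1 ((Lp.memLp V).smul hg.memLp)
  refine ext_inner_right ℝ fun a => ?_
  rw [inner_zero_left, real_inner_comm, ← integral_inner hi]
  rw [← h _ (hg.smul_const a)]
  refine integral_congr_ae (Eventually.of_forall fun x => ?_)
  simp only [inner_smul_right]
  rw [real_inner_comm]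

theorem eq_zero_of_integral_mul_test (hΩ : IsOpen Ω) (hb : Bornology.IsBounded Ω) (v : L2 Ω)
    (h : ∀ ψ : R3 → ℝ, IsTest Ω ψ → ∫ x, v x * ψ x ∂(vol Ω) = 0) : v = 0 :=
  ae_eq_zero_of_integral_smul hΩ hb v fun g hg => by
    rw [← h g hg]
    exact integral_congr_ae (Eventually.of_forall fun x => mul_comm _ _)

theorem inner_toLp_right {F : Type} [NormedAddCommGroup F] [InnerProductSpace ℝ F]
    {μ : Measure R3} (V : Lp F 2 μ) {f : R3 → F} (hf : MemLp f 2 μ) :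
    inner ℝ V hf.toLp = ∫ x, inner ℝ (V x) (f x) ∂μ := by
  rw [L2.inner_def]
  refine integral_congr_ae ?_
  filter_upwards [hf.coeFn_toLp] with x hx
  rw [hx]

/-! ### The Maxwell operator -/

theorem hasWeakCurl_iff {V W : X Ω} : HasWeakCurl Ω V W ↔ ∀ ψ (h : IsTest Ω ψ),
    inner ℝ V (memLp_curl h).toLp = inner ℝ W (h.memLp).toLp := by
  unfold HasWeakCurl
  simp_rw [inner_toLp_right]

theorem HasWeakCurl.add {V W V' W' : X Ω} (h : HasWeakCurl Ω V W) (h' : HasWeakCurl Ω V' W') :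
    HasWeakCurl Ω (V + V') (W + W') := by
  rw [hasWeakCurl_iff] at *
  intro ψ hψ
  rw [inner_add_left, inner_add_left, h ψ hψ, h' ψ hψ]

theorem HasWeakCurl.smul {V W : X Ω} (a : ℝ) (h : HasWeakCurl Ω V W) :
    HasWeakCurl Ω (a • V) (a • W) := by
  rw [hasWeakCurl_iff] at *
  intro ψ hψ
  rw [real_inner_smul_left, real_inner_smul_left, h ψ hψ]

theorem HasWeakCurl.zero : HasWeakCurl Ω 0 0 := by
  rw [hasWeakCurl_iff]; simp

theorem HasWeakCurl.eq_zero (hΩ : IsOpen Ω) (hb : Bornology.IsBounded Ω) {W : X Ω}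
    (h : HasWeakCurl Ω 0 W) : W = 0 := by
  refine eq_zero_of_integral_inner_test hΩ hb W fun ψ hψ => ?_
  have := hasWeakCurl_iff.1 h ψ hψ
  rw [inner_zero_left, inner_toLp_right] at this
  exact this.symm

theorem IsTest.hasWeakCurl {ψ : R3 → R3} (h : IsTest Ω ψ) :
    HasWeakCurl Ω h.memLp.toLp (memLp_curl h).toLp := by
  rw [hasWeakCurl_iff]
  intro χ hχ
  rw [inner_toLp_right, inner_toLp_right]
  have h1 : ∫ x, inner ℝ ((h.memLp.toLp ψ : X Ω) x) (curl χ x) ∂(vol Ω) =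
      ∫ x, inner ℝ (ψ x) (curl χ x) ∂(vol Ω) := by
    refine integral_congr_ae ?_
    filter_upwards [h.memLp.coeFn_toLp] with x hx
    rw [hx]
  have h2 : ∫ x, inner ℝ (((memLp_curl h).toLp (curl ψ) : X Ω) x) (χ x) ∂(vol Ω) =
      ∫ x, inner ℝ (curl ψ x) (χ x) ∂(vol Ω) := by
    refine integral_congr_ae ?_
    filter_upwards [(memLp_curl h).coeFn_toLp] with x hx
    rw [hx]
  rw [h1, h2, integral_inner_curl_comm h hχ]

/-- The Green formula alone characterizes the fields with vanishing tangential trace. -/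
theorem hasWeakCurlZeroTrace_iff {V W : X Ω} : HasWeakCurlZeroTrace Ω V W ↔
    ∀ P Q : X Ω, HasWeakCurl Ω P Q → inner ℝ W P = inner ℝ V Q := by
  refine ⟨fun h => h.2, fun h => ⟨?_, h⟩⟩
  rw [hasWeakCurl_iff]
  intro ψ hψ
  -- Test fields are admissible in Green's formula, their classical curl being the weak one, and
  -- this case is the definition of the weak curl.
  exact (h _ _ hψ.hasWeakCurl).symm

/-- The graph of the Maxwell operator. -/
def maxwellGraph (Ω : Set R3) : Submodule ℝ (XX Ω × XX Ω) where
  carrier := {p | IsMaxwellOp Ω p.1 p.2}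
  add_mem' := by
    rintro ⟨V, W⟩ ⟨V', W'⟩ ⟨h1, h2⟩ ⟨h1', h2'⟩
    refine ⟨hasWeakCurlZeroTrace_iff.2 fun P Q hPQ => ?_, ?_⟩
    · change inner ℝ (W.snd + W'.snd) P = inner ℝ (V.fst + V'.fst) Q
      rw [inner_add_left, inner_add_left, h1.2 P Q hPQ, h1'.2 P Q hPQ]
    · change HasWeakCurl Ω (V.snd + V'.snd) (-(W.fst + W'.fst))
      rw [neg_add]
      exact h2.add h2'
  zero_mem' := ⟨hasWeakCurlZeroTrace_iff.2 fun P Q _ => by simp, by simpa using HasWeakCurl.zero⟩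
  smul_mem' := by
    rintro a ⟨V, W⟩ ⟨h1, h2⟩
    refine ⟨hasWeakCurlZeroTrace_iff.2 fun P Q hPQ => ?_, ?_⟩
    · change inner ℝ (a • W.snd) P = inner ℝ (a • V.fst) Q
      rw [real_inner_smul_left, real_inner_smul_left, h1.2 P Q hPQ]
    · change HasWeakCurl Ω (a • V.snd) (-(a • W.fst))
      rw [← smul_neg]
      exact h2.smul a

/-- The graph of the scaled curl operator `ε curl`. -/
def curlGraph (Ω : Set R3) (ε : ℝ) : Submodule ℝ (XX Ω) where
  carrier := {p | ∀ ψ (h : IsTest Ω ψ),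
    inner ℝ p.fst (ε • (memLp_curl h).toLp) = inner ℝ p.snd (h.memLp).toLp}
  add_mem' := by
    intro p p' h h' ψ hψ
    rw [WithLp.add_fst, WithLp.add_snd, inner_add_left, inner_add_left, h ψ hψ, h' ψ hψ]
  zero_mem' := by intro ψ hψ; simp
  smul_mem' := by
    intro a p h ψ hψ
    rw [WithLp.smul_fst, WithLp.smul_snd, real_inner_smul_left, real_inner_smul_left, h ψ hψ]

theorem mem_curlGraph {ε : ℝ} (hε : ε ≠ 0) {P Q : X Ω} :
    WithLp.toLp 2 (P, ε • Q) ∈ curlGraph Ω ε ↔ HasWeakCurl Ω P Q := by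
  rw [hasWeakCurl_iff]
  refine forall₂_congr fun ψ hψ => ?_
  change inner ℝ P (ε • _) = inner ℝ (ε • Q) _ ↔ _
  rw [real_inner_smul_left, real_inner_smul_right]
  exact mul_right_inj' hε

theorem isClosed_curlGraph (ε : ℝ) : IsClosed (curlGraph Ω ε : Set (XX Ω)) := by
  have : (curlGraph Ω ε : Set (XX Ω)) = ⋂ ψ, ⋂ h : IsTest Ω ψ, {p : XX Ω |
      inner ℝ p.fst (ε • (memLp_curl h).toLp) = inner ℝ p.snd (h.memLp).toLp} := by
    ext p
    simp only [mem_iInter, mem_ofPred_eq]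
    rfl
  rw [this]
  refine isClosed_iInter fun ψ => isClosed_iInter fun h => isClosed_eq ?_ ?_
  · exact (WithLp.continuous_fst 2 _ _).inner continuous_const
  · exact (WithLp.continuous_snd 2 _ _).inner continuous_const

/-- Skewness is Green's formula for the first component, which has zero trace, against the second.
Surjectivity needs no trace theory: the boundary condition is defined by duality against all of
`H(curl; Ω)`, hence is an orthogonality relation to the graph of `ε curl`. -/
theorem isMaximalSkew_maxwellGraph (hΩ : IsOpen Ω) (hb : Bornology.IsBounded Ω) :
    IsMaximalSkew (maxwellGraph Ω) where
  skew V W h := by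
    have h1 := h.1.2 _ _ h.2
    rw [WithLp.prod_inner_apply]
    change inner ℝ V.fst W.fst + inner ℝ V.snd W.snd = 0
    rw [inner_neg_right] at h1
    rw [real_inner_comm V.snd] at h1
    linarith
  single W h := by
    have h1 := h.1.1.eq_zero hΩ hb
    have h2 := h.2.eq_zero hΩ hb
    rw [neg_eq_zero] at h2
    apply (WithLp.equiv 2 _).injective
    exact Prod.ext h2 h1
  range ε hε f := by
    have : CompleteSpace (curlGraph Ω ε) := (isClosed_curlGraph ε).completeSpace_coe
    -- Split `(f₂, -f₁) = y + z` along the closed graph of `ε curl`. The first entry of `y` is the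
    -- new `V₂`. Orthogonality of `z` says exactly that `V₁ = -z₂` has zero tangential trace and
    -- curl `ε⁻¹ z₁`.
    obtain ⟨y, hy, z, hz, hyz⟩ := (curlGraph Ω ε).exists_add_mem_mem_orthogonal
      (WithLp.toLp 2 (f.snd, -f.fst))
    have e1 : f.snd = y.fst + z.fst := congrArg WithLp.fst hyz
    have e2 : -f.fst = y.snd + z.snd := congrArg WithLp.snd hyz
    refine ⟨WithLp.toLp 2 (-z.snd, y.fst), WithLp.toLp 2 (-(ε⁻¹ • y.snd), ε⁻¹ • z.fst),
      ⟨?_, ?_⟩, ?_⟩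
    · refine hasWeakCurlZeroTrace_iff.2 fun P Q hPQ => ?_
      have h1 := (Submodule.mem_orthogonal' _ _).1 hz _ ((mem_curlGraph hε.ne').2 hPQ)
      rw [WithLp.prod_inner_apply] at h1
      change inner ℝ z.fst P + inner ℝ z.snd (ε • Q) = 0 at h1
      change inner ℝ (ε⁻¹ • z.fst) P = inner ℝ (-z.snd) Q
      rw [real_inner_smul_right] at h1
      rw [real_inner_smul_left, inner_neg_left]
      field_simp
      linarith
    · change HasWeakCurl Ω y.fst (- -(ε⁻¹ • y.snd))
      rw [neg_neg, ← mem_curlGraph hε.ne', smul_inv_smul₀ hε.ne']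
      exact hy
    · apply (WithLp.equiv 2 _).injective
      refine Prod.ext ?_ ?_
      · change -z.snd + ε • -(ε⁻¹ • y.snd) = f.fst
        rw [smul_neg, smul_inv_smul₀ hε.ne', ← neg_inj, e2]; abel
      · change y.fst + ε • ε⁻¹ • z.fst = f.snd
        rw [smul_inv_smul₀ hε.ne', e1]

theorem isMaxwellSemigroup_semigroup (hA : IsMaximalSkew (maxwellGraph Ω)) :
    IsMaxwellSemigroup Ω hA.semigroup :=
  ⟨hA.isC0Semigroup, hA.isGenerator_iff⟩

theorem IsMaxwellSemigroup.eq_semigroup (hA : IsMaximalSkew (maxwellGraph Ω))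
    {G : ℝ → XX Ω →L[ℝ] XX Ω} (hG : IsMaxwellSemigroup Ω G) {t : ℝ} (ht : 0 ≤ t) :
    G t = hA.semigroup t :=
  hA.eq_semigroup hG.1 hG.2 ht

/-! ### The very weak solution of the Dirichlet problem -/

theorem integral_mul_eq_inner {μ : Measure R3} (f g : Lp ℝ 2 μ) :
    ∫ x, f x * g x ∂μ = inner ℝ f g := by
  rw [L2.inner_def]
  exact integral_congr_ae (Eventually.of_forall fun x => by simp [mul_comm])

theorem integral_mul_eq_inner_toLp {μ : Measure R3} (f : Lp ℝ 2 μ) {ψ : R3 → ℝ}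
    (hψ : MemLp ψ 2 μ) : ∫ x, f x * ψ x ∂μ = inner ℝ f hψ.toLp := by
  rw [inner_toLp_right]
  exact integral_congr_ae (Eventually.of_forall fun x => by simp [mul_comm])

theorem continuous_gradient {ψ : R3 → ℝ} (hψ : ContDiff ℝ 1 ψ) : Continuous (gradient ψ) :=
  (InnerProductSpace.toDual ℝ R3).symm.continuous.comp (hψ.continuous_fderiv (by simp))

theorem hasCompactSupport_gradient {ψ : R3 → ℝ} (hc : HasCompactSupport ψ) :
    HasCompactSupport (gradient ψ) :=
  (hc.fderiv ℝ).comp_left (g := (InnerProductSpace.toDual ℝ R3).symm) (map_zero _)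

theorem memLp_gradient {ψ : R3 → ℝ} (hψ : ContDiff ℝ ∞ ψ) (hc : HasCompactSupport ψ) :
    MemLp (gradient ψ) 2 (vol Ω) :=
  ((continuous_gradient (hψ.of_le (by simp))).memLp_of_hasCompactSupport
    (hasCompactSupport_gradient hc)).restrict Ω

theorem memLp_vol_of_hasCompactSupport {ψ : R3 → ℝ} (hψ : ContDiff ℝ ∞ ψ)
    (hc : HasCompactSupport ψ) : MemLp ψ 2 (vol Ω) :=
  (hψ.continuous.memLp_of_hasCompactSupport hc).restrict Ω

theorem memLp_of_finite_of_hasCompactSupport {μ : Measure R3} [IsFiniteMeasure μ] {ψ : R3 → ℝ}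
    (hψ : ContDiff ℝ ∞ ψ) (hc : HasCompactSupport ψ) : MemLp ψ 2 μ := by
  obtain ⟨C, hC⟩ := hψ.continuous.bounded_above_of_compact_support hc
  exact MemLp.of_bound hψ.continuous.aestronglyMeasurable C (Eventually.of_forall hC)

theorem hasWeakDiv_iff {F : X Ω} {d : L2 Ω} : HasWeakDiv Ω F d ↔ ∀ ψ (h : IsTest Ω ψ),
    inner ℝ F (memLp_gradient h.1 h.2.1).toLp =
      -inner ℝ d (memLp_vol_of_hasCompactSupport h.1 h.2.1).toLp := by
  unfold HasWeakDiv
  refine forall₂_congr fun ψ h => ?_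
  rw [inner_toLp_right, integral_mul_eq_inner_toLp _ (memLp_vol_of_hasCompactSupport h.1 h.2.1)]

theorem hasNormalTrace_iff [IsFiniteMeasure (surf Ω)] {F : X Ω} {d : L2 Ω} {g : L2Γ Ω} :
    HasNormalTrace Ω F d g ↔ ∀ ψ (h : ContDiff ℝ ∞ ψ) (hc : HasCompactSupport ψ),
      inner ℝ F (memLp_gradient h hc).toLp +
        inner ℝ d (memLp_vol_of_hasCompactSupport h hc).toLp =
      inner ℝ g (memLp_of_finite_of_hasCompactSupport h hc).toLp := by
  unfold HasNormalTrace
  refine forall₃_congr fun ψ h hc => ?_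
  rw [inner_toLp_right, integral_mul_eq_inner_toLp _ (memLp_vol_of_hasCompactSupport h hc),
    integral_mul_eq_inner_toLp _ (memLp_of_finite_of_hasCompactSupport h hc)]

theorem isWeakPoisson_iff {g : L2 Ω} {w : HSpace Ω} : IsWeakPoisson Ω g w ↔
    ∀ (v : L2 Ω) (G : X Ω), IsH10 Ω v G → inner ℝ w.grad G = inner ℝ g v := by
  unfold IsWeakPoisson
  simp_rw [integral_mul_eq_inner, L2.inner_def]

theorem IsTest.add {F : Type} [NormedAddCommGroup F] [NormedSpace ℝ F] {ψ χ : R3 → F}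
    (hψ : IsTest Ω ψ) (hχ : IsTest Ω χ) : IsTest Ω (ψ + χ) :=
  ⟨hψ.1.add hχ.1, hψ.2.1.add hχ.2.1,
    (tsupport_add ψ χ).trans (union_subset hψ.2.2 hχ.2.2)⟩

theorem IsTest.const_smul {F : Type} [NormedAddCommGroup F] [NormedSpace ℝ F] {ψ : R3 → F}
    (a : ℝ) (hψ : IsTest Ω ψ) : IsTest Ω (a • ψ) :=
  ⟨hψ.1.const_smul a, hψ.2.1.smul_left (f := fun _ => a), (closure_mono (by
    intro x hx h; exact hx (by simp [h]))).trans hψ.2.2⟩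

/-- The pairs `(ψ, ∇ψ)` with a test function `ψ`. -/
def testPairs (Ω : Set R3) : Submodule ℝ (L2 Ω × X Ω) where
  carrier := {P : L2 Ω × X Ω | ∃ ψ : R3 → ℝ, IsTest Ω ψ ∧
    P.1 =ᵐ[vol Ω] ψ ∧ P.2 =ᵐ[vol Ω] gradient ψ}
  add_mem' := by
    rintro ⟨v, G⟩ ⟨v', G'⟩ ⟨ψ, h, h1, h2⟩ ⟨ψ', h', h1', h2'⟩
    refine ⟨ψ + ψ', h.add h', (Lp.coeFn_add _ _).trans (h1.add h1'),
      (Lp.coeFn_add _ _).trans ((h2.add h2').trans (Eventually.of_forall fun x => ?_))⟩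
    simp only [gradient, Pi.add_apply]
    rw [fderiv_add (h.1.differentiable (by simp) x) (h'.1.differentiable (by simp) x), map_add]
  zero_mem' := by
    refine ⟨0, ⟨contDiff_const, HasCompactSupport.zero, by simp⟩, Lp.coeFn_zero _ _ _,
      (Lp.coeFn_zero _ _ _).trans (Eventually.of_forall fun x => ?_)⟩
    simp [gradient]
  smul_mem' := by
    rintro a ⟨v, G⟩ ⟨ψ, h, h1, h2⟩
    refine ⟨a • ψ, h.const_smul a, (Lp.coeFn_smul _ _).trans (h1.const_smul a),
      (Lp.coeFn_smul _ _).trans ((h2.const_smul a).trans (Eventually.of_forall fun x => ?_))⟩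
    simp only [gradient, Pi.smul_apply]
    rw [fderiv_const_smul (h.1.differentiable (by simp) x), map_smul]

theorem IsTest.isH10 {ψ : R3 → ℝ} (h : IsTest Ω ψ) :
    IsH10 Ω (memLp_vol_of_hasCompactSupport h.1 h.2.1).toLp (memLp_gradient h.1 h.2.1).toLp :=
  subset_closure ⟨ψ, h, (memLp_vol_of_hasCompactSupport h.1 h.2.1).coeFn_toLp,
    (memLp_gradient h.1 h.2.1).coeFn_toLp⟩

/-- The sum of two elements of `𝓗`. -/
def HSpace.add [IsFiniteMeasure (surf Ω)] (v w : HSpace Ω) : HSpace Ω where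
  val := v.val + w.val
  grad := v.grad + w.grad
  lap := v.lap + w.lap
  normalDeriv := v.normalDeriv + w.normalDeriv
  isH10 := (testPairs Ω).topologicalClosure.add_mem v.isH10 w.isH10
  hasWeakDiv := hasWeakDiv_iff.2 fun ψ h => by
    rw [inner_add_left, inner_add_left, hasWeakDiv_iff.1 v.hasWeakDiv ψ h,
      hasWeakDiv_iff.1 w.hasWeakDiv ψ h]; ring
  hasNormalTrace := hasNormalTrace_iff.2 fun ψ h hc => by
    rw [inner_add_left, inner_add_left, inner_add_left,
      ← hasNormalTrace_iff.1 v.hasNormalTrace ψ h hc,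
      ← hasNormalTrace_iff.1 w.hasNormalTrace ψ h hc]; ring

/-- A scalar multiple of an element of `𝓗`. -/
def HSpace.smul [IsFiniteMeasure (surf Ω)] (a : ℝ) (v : HSpace Ω) : HSpace Ω where
  val := a • v.val
  grad := a • v.grad
  lap := a • v.lap
  normalDeriv := a • v.normalDeriv
  isH10 := (testPairs Ω).topologicalClosure.smul_mem a v.isH10
  hasWeakDiv := hasWeakDiv_iff.2 fun ψ h => by
    rw [real_inner_smul_left, real_inner_smul_left, hasWeakDiv_iff.1 v.hasWeakDiv ψ h]; ring
  hasNormalTrace := hasNormalTrace_iff.2 fun ψ h hc => by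
    rw [real_inner_smul_left, real_inner_smul_left, real_inner_smul_left,
      ← hasNormalTrace_iff.1 v.hasNormalTrace ψ h hc]; ring

theorem IsWeakPoisson.add [IsFiniteMeasure (surf Ω)] {g g' : L2 Ω} {w w' : HSpace Ω}
    (h : IsWeakPoisson Ω g w) (h' : IsWeakPoisson Ω g' w') :
    IsWeakPoisson Ω (g + g') (w.add w') := by
  rw [isWeakPoisson_iff] at *
  intro v G hv
  rw [HSpace.add, inner_add_left, inner_add_left, h v G hv, h' v G hv]

theorem IsWeakPoisson.smul [IsFiniteMeasure (surf Ω)] {g : L2 Ω} {w : HSpace Ω} (a : ℝ)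
    (h : IsWeakPoisson Ω g w) : IsWeakPoisson Ω (a • g) (w.smul a) := by
  rw [isWeakPoisson_iff] at *
  intro v G hv
  rw [HSpace.smul, real_inner_smul_left, real_inner_smul_left, h v G hv]

theorem IsWeakPoisson.lap_eq (hΩ : IsOpen Ω) (hb : Bornology.IsBounded Ω) {g : L2 Ω}
    {w : HSpace Ω} (h : IsWeakPoisson Ω g w) : w.lap = -g := by
  rw [← add_eq_zero_iff_eq_neg]
  refine eq_zero_of_integral_mul_test hΩ hb _ fun ψ hψ => ?_
  rw [integral_mul_eq_inner_toLp _ (memLp_vol_of_hasCompactSupport hψ.1 hψ.2.1), inner_add_left,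
    ← isWeakPoisson_iff.1 h _ _ hψ.isH10, hasWeakDiv_iff.1 w.hasWeakDiv ψ hψ]
  ring

/-- For test functions this is the definition of the distributional Laplacian, and the identity is
closed in `(w, G)`. With uniqueness, testing with all of `𝓗` amounts to testing with all right-hand
sides in `L²(Ω)`. -/
theorem HSpace.isWeakPoisson (v : HSpace Ω) : IsWeakPoisson Ω (-v.lap) v := by
  rw [isWeakPoisson_iff]
  intro w G h
  have hcl : IsClosed {p : L2 Ω × X Ω | inner ℝ v.grad p.2 = inner ℝ (-v.lap) p.1} :=
    isClosed_eq (continuous_const.inner continuous_snd) (continuous_const.inner continuous_fst)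
  refine closure_minimal ?_ hcl h
  rintro ⟨w, G⟩ ⟨ψ, hψ, h1, h2⟩
  have e1 : w = (memLp_vol_of_hasCompactSupport hψ.1 hψ.2.1).toLp :=
    Lp.ext (h1.trans (MemLp.coeFn_toLp _).symm)
  have e2 : G = (memLp_gradient hψ.1 hψ.2.1).toLp :=
    Lp.ext (h2.trans (MemLp.coeFn_toLp _).symm)
  change inner ℝ v.grad G = inner ℝ (-v.lap) w
  rw [e1, e2, hasWeakDiv_iff.1 v.hasWeakDiv ψ hψ, inner_neg_left]

/-- The Dirichlet problem with boundary data in `L²(Γ)` has a unique very weak solution, which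
depends continuously and linearly on the data. -/
theorem exists_isVeryWeakSolution_iff (hΩ : IsOpen Ω) (hb : Bornology.IsBounded Ω)
    [IsFiniteMeasure (surf Ω)] (hreg : PoissonRegular Ω) :
    ∃ S : L2Γ Ω →L[ℝ] L2 Ω, ∀ u η, IsVeryWeakSolution Ω u η ↔ η = S u := by
  obtain ⟨C, -, hC⟩ := hreg
  choose w hw huniq using fun g => (hC g).1
  -- Data to normal derivative: linearity comes from unique solvability, boundedness from the
  -- `𝓗`-estimate.
  let N : L2 Ω →L[ℝ] L2Γ Ω := LinearMap.mkContinuous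
    { toFun := fun g => (w g).normalDeriv
      map_add' := fun g g' => by rw [← huniq (g + g') _ ((hw g).add (hw g'))]; rfl
      map_smul' := fun a g => by rw [← huniq (a • g) _ ((hw g).smul a)]; rfl }
    C fun g => by
      refine le_trans ?_ ((hC g).2 _ (hw g))
      refine Real.le_sqrt_of_sq_le ?_
      change ‖(w g).normalDeriv‖ ^ 2 ≤ _
      nlinarith [sq_nonneg ‖(w g).val‖, sq_nonneg ‖(w g).grad‖, sq_nonneg ‖(w g).lap‖]
  have hN : ∀ v : HSpace Ω, v.normalDeriv = N (-v.lap) := fun v => by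
    change _ = (w (-v.lap)).normalDeriv
    rw [← huniq _ v v.isWeakPoisson]
  refine ⟨-(ContinuousLinearMap.adjoint N), fun u η => ?_⟩
  -- Substituting `g = -Δv` turns the very weak formulation into an adjoint equation.
  have hmain : IsVeryWeakSolution Ω u η ↔ ∀ g : L2 Ω, inner ℝ η g + inner ℝ u (N g) = 0 := by
    unfold IsVeryWeakSolution
    simp_rw [integral_mul_eq_inner]
    constructor
    · intro h g
      have := h (w g)
      rw [hN, (hw g).lap_eq hΩ hb, inner_neg_right, neg_neg, neg_neg] at this
      exact this
    · intro h v
      have := h (-v.lap)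
      rwa [inner_neg_right, ← hN] at this
  rw [hmain]
  simp_rw [← ContinuousLinearMap.adjoint_inner_left, ← inner_add_left]
  constructor
  · intro h
    rw [neg_apply]
    exact eq_neg_of_add_eq_zero_left (inner_self_eq_zero.1 (h _))
  · rintro rfl g
    simp

/-! ### Measurability of the normal -/

/-- For unit vectors `ν ≠ ν'`, moving from `x` a little along `d = ν' - ν` goes strictly inwards for
`ν` and strictly outwards for `ν'`. The slopes are `∓‖d‖/2`, so the tolerance `‖d‖/4` puts the point
both in and out of `Ω`. -/
theorem IsOutwardUnitNormal.unique {x ν ν' : R3} (h : IsOutwardUnitNormal Ω x ν)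
    (h' : IsOutwardUnitNormal Ω x ν') : ν = ν' := by
  by_contra hne
  set d := ν' - ν with hd
  have hd0 : 0 < ‖d‖ := norm_pos_iff.2 (sub_ne_zero.2 (Ne.symm hne))
  have hsq : ‖d‖ ^ 2 = 2 - 2 * inner ℝ ν' ν := by
    rw [hd, norm_sub_sq_real, h.1, h'.1]; ring
  have e1 : inner ℝ d ν = -(‖d‖ ^ 2 / 2) := by
    rw [hsq, hd, inner_sub_left, real_inner_self_eq_norm_sq, h.1]; ring
  have e2 : inner ℝ d ν' = ‖d‖ ^ 2 / 2 := by
    rw [hsq, hd, inner_sub_left, real_inner_self_eq_norm_sq, h'.1, real_inner_comm]; ring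
  obtain ⟨δ, hδ, H⟩ := h.2 (‖d‖ / 4) (by positivity)
  obtain ⟨δ', hδ', H'⟩ := h'.2 (‖d‖ / 4) (by positivity)
  set s := min δ δ' / (2 * ‖d‖) with hs
  have hs0 : 0 < s := by positivity
  have hdist : dist (x + s • d) x < min δ δ' := by
    rw [dist_eq_norm, add_sub_cancel_left, norm_smul, Real.norm_of_nonneg hs0.le, hs]
    have : min δ δ' / (2 * ‖d‖) * ‖d‖ = min δ δ' / 2 := by field_simp
    rw [this]
    have : 0 < min δ δ' := lt_min hδ hδ'
    linarith
  have hpos : 0 < s * ‖d‖ ^ 2 := by positivity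
  refine (H' _ (hdist.trans_le (min_le_right _ _))).2 ?_ ((H _ (hdist.trans_le (min_le_left _ _))).1 ?_)
  · rw [add_sub_cancel_left, norm_smul, Real.norm_of_nonneg hs0.le, real_inner_smul_left, e2]
    nlinarith
  · rw [add_sub_cancel_left, norm_smul, Real.norm_of_nonneg hs0.le, real_inner_smul_left, e1]
    nlinarith

/-- The pairs `(x, ν)` such that `Ω` is `ε`-close to the half-space with normal `ν` in the
`δ`-ball around `x`. -/
def nearNormal (Ω : Set R3) (ε δ : ℝ) : Set (R3 × R3) :=
  {p | ∀ y : R3, dist y p.1 < δ → (inner ℝ (y - p.1) p.2 < -ε * ‖y - p.1‖ → y ∈ Ω) ∧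
    (ε * ‖y - p.1‖ < inner ℝ (y - p.1) p.2 → y ∉ Ω)}

/-- For a fixed `y`, whether `y ∈ Ω` does not depend on the pair, so violation at `y` is a strict,
hence open, condition; no regularity of `Ω` enters. -/
theorem isClosed_nearNormal (ε δ : ℝ) : IsClosed (nearNormal Ω ε δ) := by
  have : nearNormal Ω ε δ = ⋂ y : R3,
      {p | dist y p.1 < δ ∧ ((inner ℝ (y - p.1) p.2 < -ε * ‖y - p.1‖ ∧ y ∉ Ω) ∨
        (ε * ‖y - p.1‖ < inner ℝ (y - p.1) p.2 ∧ y ∈ Ω))}ᶜ := by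
    ext p
    simp only [nearNormal, mem_ofPred_eq, mem_iInter, mem_compl_iff]
    refine forall_congr' fun y => ?_
    tauto
  rw [this]
  refine isClosed_iInter fun y => IsOpen.isClosed_compl ?_
  have h1 : IsOpen {p : R3 × R3 | dist y p.1 < δ} := isOpen_lt (by fun_prop) (by fun_prop)
  have h2 : IsOpen {p : R3 × R3 | inner ℝ (y - p.1) p.2 < -ε * ‖y - p.1‖} :=
    isOpen_lt (by fun_prop) (by fun_prop)
  have h3 : IsOpen {p : R3 × R3 | ε * ‖y - p.1‖ < inner ℝ (y - p.1) p.2} :=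
    isOpen_lt (by fun_prop) (by fun_prop)
  exact h1.inter ((h2.inter isOpen_const).union (h3.inter isOpen_const))

theorem nearNormal_mono {ε ε' δ δ' : ℝ} (hε : ε ≤ ε') (hδ : δ' ≤ δ) :
    nearNormal Ω ε δ ⊆ nearNormal Ω ε' δ' := by
  intro p hp y hy
  have h := hp y (hy.trans_le hδ)
  have hm := mul_le_mul_of_nonneg_right hε (norm_nonneg (y - p.1))
  exact ⟨fun h1 => h.1 (by linarith), fun h1 => h.2 (by linarith)⟩

theorem measurableSet_graph_normal :
    MeasurableSet {p : R3 × R3 | IsOutwardUnitNormal Ω p.1 p.2} := by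
  have : {p : R3 × R3 | IsOutwardUnitNormal Ω p.1 p.2} = {p | ‖p.2‖ = 1} ∩
      ⋂ k : ℕ, ⋃ n : ℕ, nearNormal Ω ((k + 1 : ℝ)⁻¹) ((n + 1 : ℝ)⁻¹) := by
    ext p
    simp only [mem_inter_iff, mem_iInter, mem_iUnion, mem_ofPred_eq, IsOutwardUnitNormal]
    refine and_congr_right fun _ => ⟨fun h k => ?_, fun h ε hε => ?_⟩
    · obtain ⟨δ, hδ, H⟩ := h ((k + 1 : ℝ)⁻¹) (by positivity)
      obtain ⟨n, hn⟩ := exists_nat_one_div_lt hδ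
      rw [one_div] at hn
      exact ⟨n, nearNormal_mono le_rfl hn.le H⟩
    · obtain ⟨k, hk⟩ := exists_nat_one_div_lt hε
      rw [one_div] at hk
      obtain ⟨n, hn⟩ := h k
      exact ⟨_, by positivity, nearNormal_mono hk.le le_rfl hn⟩
  rw [this]
  refine MeasurableSet.inter (isClosed_eq (by fun_prop) continuous_const).measurableSet ?_
  exact MeasurableSet.iInter fun k => MeasurableSet.iUnion fun n =>
    (isClosed_nearNormal _ _).measurableSet

theorem outwardNormal_eq {x ν : R3} (h : IsOutwardUnitNormal Ω x ν) : outwardNormal Ω x = ν := by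
  have hex : ∃ ν, IsOutwardUnitNormal Ω x ν := ⟨ν, h⟩
  rw [outwardNormal, dif_pos hex]
  exact hex.choose_spec.unique h

theorem outwardNormal_eq_zero {x : R3} (h : ¬∃ ν, IsOutwardUnitNormal Ω x ν) :
    outwardNormal Ω x = 0 := by
  rw [outwardNormal, dif_neg h]

theorem norm_outwardNormal_le (x : R3) : ‖outwardNormal Ω x‖ ≤ 1 := by
  by_cases h : ∃ ν, IsOutwardUnitNormal Ω x ν
  · obtain ⟨ν, hν⟩ := h
    rw [outwardNormal_eq hν, hν.1]
  · rw [outwardNormal_eq_zero h]; simp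

/-- The graph of the normal is Borel and, by uniqueness, projects injectively to the base point;
injective continuous images of Borel sets are Borel (Lusin–Souslin). Without measurability the
boundary term of the force could not be estimated as an integral. -/
theorem measurable_outwardNormal : Measurable (outwardNormal Ω) := by
  have himg : ∀ A : Set R3, MeasurableSet A →
      MeasurableSet {x | ∃ ν ∈ A, IsOutwardUnitNormal Ω x ν} := by
    intro A hA
    have : {x | ∃ ν ∈ A, IsOutwardUnitNormal Ω x ν} =
        Prod.fst '' ({p : R3 × R3 | IsOutwardUnitNormal Ω p.1 p.2} ∩ Prod.snd ⁻¹' A) := by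
      ext x
      constructor
      · rintro ⟨ν, hν, h⟩; exact ⟨(x, ν), ⟨h, hν⟩, rfl⟩
      · rintro ⟨⟨x, ν⟩, ⟨h, hν⟩, rfl⟩; exact ⟨ν, hν, h⟩
    rw [this]
    refine (measurableSet_graph_normal.inter (measurable_snd hA)).image_of_continuousOn_injOn
      continuous_fst.continuousOn ?_
    rintro ⟨x, ν⟩ ⟨h, -⟩ ⟨x', ν'⟩ ⟨h', -⟩ rfl
    exact Prod.ext rfl (IsOutwardUnitNormal.unique h h')
  intro A hA
  have : outwardNormal Ω ⁻¹' A = {x | ∃ ν ∈ A, IsOutwardUnitNormal Ω x ν} ∪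
      ({x | ∃ ν ∈ univ, IsOutwardUnitNormal Ω x ν}ᶜ ∩ {_x | (0 : R3) ∈ A}) := by
    ext x
    simp only [mem_preimage, mem_union, mem_ofPred_eq, mem_inter_iff, mem_compl_iff, mem_univ,
      true_and]
    by_cases h : ∃ ν, IsOutwardUnitNormal Ω x ν
    · obtain ⟨ν, hν⟩ := h
      rw [outwardNormal_eq hν]
      refine ⟨fun h => Or.inl ⟨ν, h, hν⟩, ?_⟩
      rintro (⟨ν', h', hν'⟩ | ⟨h', -⟩)
      · rwa [hν.unique hν']
      · exact absurd ⟨ν, hν⟩ h'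
    · rw [outwardNormal_eq_zero h]
      refine ⟨fun h0 => Or.inr ⟨h, h0⟩, ?_⟩
      rintro (⟨ν', h', hν'⟩ | ⟨-, h'⟩)
      · exact absurd ⟨ν', hν'⟩ h
      · exact h'
  rw [this]
  exact (himg A hA).union ((himg univ MeasurableSet.univ).compl.inter (MeasurableSet.const _))

/-! ### Causal integral equations -/

section Volterra

variable {E : Type} [NormedAddCommGroup E] {T L : ℝ} {Φ : (ℝ → E) → ℝ → E}

/-- `Φ` maps continuous functions to continuous functions, and the value of `Φ y` at `t ∈ [0,T]`
depends on the values of `y` in `[0,t]` only, in a Lipschitz continuous way. -/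
structure IsCausal (T L : ℝ) (Φ : (ℝ → E) → ℝ → E) : Prop where
  continuous : ∀ y, Continuous y → Continuous (Φ y)
  lipschitz : ∀ y y', Continuous y → Continuous y' → ∀ t ∈ Icc 0 T, ∀ b : ℝ,
    (∀ s ∈ Icc 0 t, ‖y s - y' s‖ ≤ b) → ‖Φ y t - Φ y' t‖ ≤ L * b

theorem IsCausal.eqOn (hΦ : IsCausal T L Φ) {y y' : ℝ → E} (hy : Continuous y)
    (hy' : Continuous y') (h : EqOn y y' (Icc 0 T)) : EqOn (Φ y) (Φ y') (Icc 0 T) := by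
  intro t ht
  have := hΦ.lipschitz y y' hy hy' t ht 0 fun s hs => by
    rw [h ⟨hs.1, hs.2.trans ht.2⟩, sub_self, norm_zero]
  rw [mul_zero] at this
  exact sub_eq_zero.1 (norm_le_zero_iff.1 this)

variable [NormedSpace ℝ E]

/-- The Picard operator `y ↦ ∫₀ Φ y`. -/
def IsCausal.picard (hΦ : IsCausal T L Φ) (hT : 0 ≤ T) (y : C(Icc 0 T, E)) : C(Icc 0 T, E) where
  toFun t := ∫ s in (0 : ℝ)..t, Φ (IccExtend hT y) s
  continuous_toFun :=
    (intervalIntegral.continuous_primitive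
      (fun _ _ => (hΦ.continuous _ y.continuous.Icc_extend').intervalIntegrable _ _) 0).comp
      continuous_subtype_val

/-- Causality lets the bound at time `s` use only the previous iterates on `[0,s]`, so each
integration raises the power of `t` and supplies one factor of the factorial. -/
theorem IsCausal.norm_iterate_picard_sub_le (hΦ : IsCausal T L Φ) (hT : 0 ≤ T) (hL : 0 ≤ L) (n : ℕ)
    (y y' : C(Icc 0 T, E)) (t : Icc 0 T) :
    ‖(hΦ.picard hT)^[n] y t - (hΦ.picard hT)^[n] y' t‖ ≤
      (L * t) ^ n / n.factorial * dist y y' := by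
  induction n generalizing t with
  | zero => simpa [dist_eq_norm] using ContinuousMap.dist_apply_le_dist (f := y) (g := y') t
  | succ n ih =>
    rw [Function.iterate_succ_apply', Function.iterate_succ_apply']
    set a := (hΦ.picard hT)^[n] y
    set b := (hΦ.picard hT)^[n] y'
    have ht : (0 : ℝ) ≤ t := t.2.1
    have hca := hΦ.continuous _ (a.continuous.Icc_extend' (h := hT))
    have hcb := hΦ.continuous _ (b.continuous.Icc_extend' (h := hT))
    change ‖(∫ s in (0 : ℝ)..t, Φ (IccExtend hT a) s) - ∫ s in (0 : ℝ)..t, Φ (IccExtend hT b) s‖ ≤ _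
    rw [← intervalIntegral.integral_sub (hca.intervalIntegrable _ _) (hcb.intervalIntegrable _ _)]
    have hint : ∫ s in (0 : ℝ)..t, L ^ (n + 1) / n.factorial * dist y y' * s ^ n =
        (L * t) ^ (n + 1) / (n + 1).factorial * dist y y' := by
      rw [intervalIntegral.integral_const_mul, integral_pow, Nat.factorial_succ]
      push_cast
      field_simp
      simp
      ring
    rw [← hint]
    refine intervalIntegral.norm_integral_le_of_norm_le ht
      (Eventually.of_forall fun s hs => ?_) (Continuous.intervalIntegrable (by fun_prop) _ _)
    have hsT : s ≤ T := hs.2.trans t.2.2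
    refine (hΦ.lipschitz _ _ a.continuous.Icc_extend' b.continuous.Icc_extend' s
      ⟨hs.1.le, hsT⟩ ((L * s) ^ n / n.factorial * dist y y') fun τ hτ => ?_).trans (le_of_eq ?_)
    · have hτT : τ ∈ Icc 0 T := ⟨hτ.1, hτ.2.trans hsT⟩
      rw [IccExtend_of_mem hT _ hτT, IccExtend_of_mem hT _ hτT]
      refine (ih ⟨τ, hτT⟩).trans ?_
      have h0 : 0 ≤ L * τ := mul_nonneg hL hτ.1
      have h1 : L * τ ≤ L * s := mul_le_mul_of_nonneg_left hτ.2 hL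
      have h2 := pow_le_pow_left₀ h0 h1 n
      dsimp only
      gcongr
    · ring

theorem IsCausal.exists_contracting (hΦ : IsCausal T L Φ) (hT : 0 ≤ T) (hL : 0 ≤ L) :
    ∃ n : ℕ, ∃ K, ContractingWith K (hΦ.picard hT)^[n] := by
  have h := FloorSemiring.tendsto_pow_div_factorial_atTop (L * T)
  obtain ⟨n, hn⟩ := (h.eventually (gt_mem_nhds (show (0 : ℝ) < 1 / 2 by norm_num))).exists
  refine ⟨n, 1 / 2, by norm_num, LipschitzWith.of_dist_le_mul fun y y' => ?_⟩
  refine (ContinuousMap.dist_le (by positivity)).2 fun t => ?_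
  rw [dist_eq_norm]
  refine (hΦ.norm_iterate_picard_sub_le hT hL n y y' t).trans ?_
  refine mul_le_mul_of_nonneg_right ?_ dist_nonneg
  refine le_trans ?_ (hn.le.trans (by norm_num))
  have h0 : 0 ≤ L * (t : ℝ) := mul_nonneg hL t.2.1
  have h1 : L * (t : ℝ) ≤ L * T := mul_le_mul_of_nonneg_left t.2.2 hL
  gcongr

/-- The integral equation `y = ∫₀ Φ y` has at most one solution. -/
theorem IsCausal.unique [CompleteSpace E] (hΦ : IsCausal T L Φ) (hT : 0 ≤ T) (hL : 0 ≤ L)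
    {y y' : ℝ → E} (hy : Continuous y) (hy' : Continuous y')
    (h : ∀ t ∈ Icc 0 T, y t = ∫ s in (0 : ℝ)..t, Φ y s)
    (h' : ∀ t ∈ Icc 0 T, y' t = ∫ s in (0 : ℝ)..t, Φ y' s) : EqOn y y' (Icc 0 T) := by
  obtain ⟨n, K, hK⟩ := hΦ.exists_contracting hT hL
  -- A solution restricted to `[0,T]` is a fixed point: by causality, replacing it outside `[0,T]`
  -- by the constant extension does not change `Φ` on `[0,T]`.
  have hfix : ∀ y (hy : Continuous y), (∀ t ∈ Icc 0 T, y t = ∫ s in (0 : ℝ)..t, Φ y s) →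
      Function.IsFixedPt (hΦ.picard hT) (⟨fun t : Icc 0 T => y t, by fun_prop⟩ : C(Icc 0 T, E)) := by
    intro y hy h
    ext t
    change ∫ s in (0 : ℝ)..t, Φ (IccExtend hT _) s = y t
    rw [h t t.2]
    refine intervalIntegral.integral_congr fun s hs => ?_
    rw [uIcc_of_le t.2.1] at hs
    refine hΦ.eqOn (Continuous.Icc_extend' (by fun_prop)) hy (fun τ hτ => ?_)
      ⟨hs.1, hs.2.trans t.2.2⟩
    rw [IccExtend_of_mem hT _ hτ]
    rfl
  have := hK.fixedPoint_unique' ((hfix y hy h).iterate n) ((hfix y' hy' h').iterate n)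
  intro t ht
  exact DFunLike.congr_fun this ⟨t, ht⟩

/-- The integral equation `Y = ∫₀ Φ Y` has a solution on `[0,T]`. -/
theorem IsCausal.exists_solution [CompleteSpace E] (hΦ : IsCausal T L Φ) (hT : 0 ≤ T)
    (hL : 0 ≤ L) : ∃ Y f : ℝ → E, Continuous f ∧ (∀ t, HasDerivAt Y (f t) t) ∧ Y 0 = 0 ∧
      EqOn f (Φ Y) (Icc 0 T) := by
  obtain ⟨n, K, hK⟩ := hΦ.exists_contracting hT hL
  have hfix := hK.isFixedPt_fixedPoint_iterate
  set y := ContractingWith.fixedPoint (hΦ.picard hT)^[n] hK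
  have hc := hΦ.continuous _ (y.continuous.Icc_extend' (h := hT))
  have hd : ∀ t, HasDerivAt (fun t => ∫ s in (0 : ℝ)..t, Φ (IccExtend hT y) s)
      (Φ (IccExtend hT y) t) t := fun t =>
    intervalIntegral.integral_hasDerivAt_right (hc.intervalIntegrable _ _)
      (hc.stronglyMeasurableAtFilter _ _) hc.continuousAt
  -- The primitive, not the extended fixed point, is taken as solution: it agrees with it on `[0,T]`
  -- and is differentiable on the whole line, endpoints included.
  refine ⟨fun t => ∫ s in (0 : ℝ)..t, Φ (IccExtend hT y) s, Φ (IccExtend hT y), hc, hd, by simp,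
    hΦ.eqOn y.continuous.Icc_extend'
      (continuous_iff_continuousAt.2 fun t => (hd t).continuousAt) fun t ht => ?_⟩
  rw [IccExtend_of_mem hT _ ht]
  exact (DFunLike.congr_fun hfix ⟨t, ht⟩).symm

end Volterra

/-! ### Pairings of square integrable functions with Lipschitz kernels -/

section Kernel

variable {K F G : Type} [NormedAddCommGroup K] [NormedAddCommGroup F] [NormedAddCommGroup G]
  {μ : Measure R3}

theorem integral_norm_le_norm [IsFiniteMeasure μ] (f : Lp F 2 μ) :
    ∫ x, ‖f x‖ ∂μ ≤ (μ univ ^ (1 / 2 : ℝ)).toReal * ‖f‖ := by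
  have hf := (Lp.memLp f).aestronglyMeasurable
  rw [integral_norm_eq_lintegral_enorm hf, ← eLpNorm_one_eq_lintegral_enorm, Lp.norm_def, mul_comm,
    ← ENNReal.toReal_mul]
  have h := eLpNorm_le_eLpNorm_mul_rpow_measure_univ (μ := μ) (p := 1) (q := 2) (by norm_num) hf
  have he : 1 / (1 : ENNReal).toReal - 1 / (2 : ENNReal).toReal = (1 / 2 : ℝ) := by norm_num
  rw [he] at h
  refine ENNReal.toReal_mono (ENNReal.mul_ne_top (Lp.eLpNorm_ne_top f) ?_) h
  exact ENNReal.rpow_ne_top_of_nonneg (by norm_num) (measure_ne_top μ univ)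

/-- `κ r` is a family of measurable functions, bounded and Lipschitz continuous in `r`. -/
structure IsLipKernel (μ : Measure R3) (κ : R3 → R3 → K) (b : ℝ) : Prop where
  meas : ∀ r, AEStronglyMeasurable (κ r) μ
  bound : ∀ r x, ‖κ r x‖ ≤ b
  lip : ∀ r r' x, ‖κ r x - κ r' x‖ ≤ b * ‖r - r'‖

variable [NormedSpace ℝ K] [NormedSpace ℝ F] [NormedSpace ℝ G] {κ : R3 → R3 → K} {b : ℝ}
  (B : K →L[ℝ] F →L[ℝ] G)

theorem integrable_of_norm_le [IsFiniteMeasure μ] (hB : ∀ k f, ‖B k f‖ ≤ ‖k‖ * ‖f‖) {k : R3 → K}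
    (hk : AEStronglyMeasurable k μ) (hb : ∀ x, ‖k x‖ ≤ b) (f : Lp F 2 μ) :
    Integrable (fun x => B (k x) (f x)) μ := by
  have hf : Integrable f μ := (Lp.memLp f).integrable (by norm_num)
  refine (hf.norm.const_mul b).mono' (B.aestronglyMeasurable_comp₂ hk hf.aestronglyMeasurable)
    (Eventually.of_forall fun x => (hB _ _).trans ?_)
  exact mul_le_mul_of_nonneg_right (hb x) (norm_nonneg _)

theorem norm_integral_le_of_norm_le [IsFiniteMeasure μ] (hB : ∀ k f, ‖B k f‖ ≤ ‖k‖ * ‖f‖)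
    {k : R3 → K} (hb : ∀ x, ‖k x‖ ≤ b) (f : Lp F 2 μ) :
    ‖∫ x, B (k x) (f x) ∂μ‖ ≤ b * (μ univ ^ (1 / 2 : ℝ)).toReal * ‖f‖ := by
  have hf : Integrable f μ := (Lp.memLp f).integrable (by norm_num)
  have hb0 : 0 ≤ b := (norm_nonneg _).trans (hb 0)
  refine (MeasureTheory.norm_integral_le_of_norm_le (hf.norm.const_mul b)
    (Eventually.of_forall fun x => (hB _ _).trans
      (mul_le_mul_of_nonneg_right (hb x) (norm_nonneg _)))).trans ?_
  rw [integral_const_mul, mul_assoc]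
  exact mul_le_mul_of_nonneg_left (integral_norm_le_norm f) hb0

theorem IsLipKernel.norm_integral_le [IsFiniteMeasure μ] (hB : ∀ k f, ‖B k f‖ ≤ ‖k‖ * ‖f‖)
    (hκ : IsLipKernel μ κ b) (r : R3) (f : Lp F 2 μ) :
    ‖∫ x, B (κ r x) (f x) ∂μ‖ ≤ b * (μ univ ^ (1 / 2 : ℝ)).toReal * ‖f‖ :=
  norm_integral_le_of_norm_le B hB (hκ.bound r) f

/-- Change the kernel first, then the function. Only the kernel has to be regular in `r`, so `f` may
be merely square integrable. -/
theorem IsLipKernel.norm_integral_sub_le [IsFiniteMeasure μ]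
    (hB : ∀ k f, ‖B k f‖ ≤ ‖k‖ * ‖f‖) (hκ : IsLipKernel μ κ b) (r r' : R3) (f f' : Lp F 2 μ) :
    ‖(∫ x, B (κ r x) (f x) ∂μ) - ∫ x, B (κ r' x) (f' x) ∂μ‖ ≤
      b * (μ univ ^ (1 / 2 : ℝ)).toReal * (‖r - r'‖ * ‖f‖ + ‖f - f'‖) := by
  have hi := fun r f => integrable_of_norm_le B hB (hκ.meas r) (hκ.bound r) f
  have e1 : (∫ x, B (κ r x) (f x) ∂μ) - ∫ x, B (κ r' x) (f x) ∂μ =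
      ∫ x, B (κ r x - κ r' x) (f x) ∂μ := by
    rw [← integral_sub (hi r f) (hi r' f)]
    exact integral_congr_ae (Eventually.of_forall fun x => by simp)
  have e2 : (∫ x, B (κ r' x) (f x) ∂μ) - ∫ x, B (κ r' x) (f' x) ∂μ =
      ∫ x, B (κ r' x) ((f - f' : Lp F 2 μ) x) ∂μ := by
    rw [← integral_sub (hi r' f) (hi r' f')]
    refine integral_congr_ae ?_
    filter_upwards [Lp.coeFn_sub f f'] with x hx
    rw [hx, Pi.sub_apply, map_sub]
  have h1 := norm_integral_le_of_norm_le B hB (k := fun x => κ r x - κ r' x) (hκ.lip r r') f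
  have h2 := norm_integral_le_of_norm_le B hB (hκ.bound r') (f - f')
  rw [← e1] at h1
  rw [← e2] at h2
  refine (norm_sub_le_norm_sub_add_norm_sub _ (∫ x, B (κ r' x) (f x) ∂μ) _).trans ?_
  calc _ ≤ _ := add_le_add h1 h2
    _ = _ := by ring

end Kernel

/-! ### The particle -/

theorem cross_apply_eq (a b : R3) : cross a b =
    !₂[a 1 * b 2 - a 2 * b 1, a 2 * b 0 - a 0 * b 2, a 0 * b 1 - a 1 * b 0] := by
  rw [cross, cross_apply]

theorem norm_cross_le (a b : R3) : ‖cross a b‖ ≤ ‖a‖ * ‖b‖ := by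
  refine le_of_sq_le_sq ?_ (by positivity)
  rw [mul_pow, cross_apply_eq]
  simp only [EuclideanSpace.real_norm_sq_eq, Fin.sum_univ_three]
  simp
  -- Lagrange's identity: the difference of the two sides is the square of the dot product.
  nlinarith [sq_nonneg (a 0 * b 0 + a 1 * b 1 + a 2 * b 2)]

/-- The cross product as a continuous bilinear map. -/
def crossL : R3 →L[ℝ] R3 →L[ℝ] R3 :=
  LinearMap.mkContinuous₂
    (LinearMap.mk₂ ℝ cross
      (fun a a' b => by ext i; fin_cases i <;> simp [cross_apply_eq] <;> ring)
      (fun t a b => by ext i; fin_cases i <;> simp [cross_apply_eq] <;> ring)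
      (fun a b b' => by ext i; fin_cases i <;> simp [cross_apply_eq] <;> ring)
      (fun t a b => by ext i; fin_cases i <;> simp [cross_apply_eq] <;> ring))
    1 fun a b => by simpa using norm_cross_le a b

@[simp]
theorem crossL_apply (a b : R3) : crossL a b = cross a b := rfl

theorem norm_cross_sub_le (a a' b b' : R3) :
    ‖cross a b - cross a' b'‖ ≤ ‖a - a'‖ * ‖b‖ + ‖a'‖ * ‖b - b'‖ := by
  have : cross a b - cross a' b' = cross (a - a') b + cross a' (b - b') := by
    simp only [← crossL_apply, map_sub, sub_apply]; abel
  rw [this]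
  exact (norm_add_le _ _).trans (add_le_add (norm_cross_le _ _) (norm_cross_le _ _))

variable {m c : ℝ}

theorem one_le_lorentzFactor (m c : ℝ) (p : R3) : 1 ≤ lorentzFactor m c p := by
  rw [lorentzFactor, Real.one_le_sqrt]
  have : 0 ≤ ‖p‖ ^ 2 / (m * c) ^ 2 := by positivity
  linarith

theorem norm_le_lorentzFactor (hm : 0 < m) (hc : 0 < c) (p : R3) :
    ‖p‖ ≤ m * c * lorentzFactor m c p := by
  have h : ‖p‖ / (m * c) ≤ lorentzFactor m c p := by
    refine Real.le_sqrt_of_sq_le ?_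
    rw [div_pow]; linarith
  rw [div_le_iff₀ (by positivity)] at h
  linarith

/-- The quantity `(mc)²γ² - ‖p‖²` is constant. Factor the differences of squares and use `‖p‖ + ‖p'‖
≤ mc(γ + γ')`. -/
theorem abs_lorentzFactor_sub_le (hm : 0 < m) (hc : 0 < c) (p p' : R3) :
    |lorentzFactor m c p - lorentzFactor m c p'| ≤ ‖p - p'‖ / (m * c) := by
  have hγ := one_le_lorentzFactor m c p
  have hγ' := one_le_lorentzFactor m c p'
  have hn := norm_le_lorentzFactor hm hc p
  have hn' := norm_le_lorentzFactor hm hc p'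
  have hsq : ∀ p : R3, (m * c) ^ 2 * lorentzFactor m c p ^ 2 = (m * c) ^ 2 + ‖p‖ ^ 2 := by
    intro p
    rw [lorentzFactor, Real.sq_sqrt (by positivity)]
    field_simp
  have hmc : 0 < m * c := by positivity
  rw [le_div_iff₀ hmc]
  refine le_trans ?_ (abs_norm_sub_norm_le p p')
  set g := lorentzFactor m c p
  set g' := lorentzFactor m c p'
  have hs : 0 < m * c * (g + g') := by positivity
  have h1 : |g - g'| * (m * c) * (m * c * (g + g')) = |‖p‖ - ‖p'‖| * (‖p‖ + ‖p'‖) := by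
    have e1 : |g - g'| * (m * c) * (m * c * (g + g')) = |(g - g') * ((m * c) ^ 2 * (g + g'))| := by
      rw [abs_mul, abs_of_pos (by positivity : 0 < (m * c) ^ 2 * (g + g'))]; ring
    have e2 : |‖p‖ - ‖p'‖| * (‖p‖ + ‖p'‖) = |(‖p‖ - ‖p'‖) * (‖p‖ + ‖p'‖)| := by
      rw [abs_mul, abs_of_nonneg (by positivity : 0 ≤ ‖p‖ + ‖p'‖)]
    rw [e1, e2]
    congr 1
    linear_combination hsq p - hsq p'
  have h2 : |‖p‖ - ‖p'‖| * (‖p‖ + ‖p'‖) ≤ |‖p‖ - ‖p'‖| * (m * c * (g + g')) :=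
    mul_le_mul_of_nonneg_left (by linarith) (abs_nonneg _)
  rw [← h1] at h2
  exact le_of_mul_le_mul_right h2 hs

theorem norm_velocity_le (hm : 0 < m) (hc : 0 < c) (p : R3) : ‖velocity m c p‖ ≤ c := by
  have hγ := one_le_lorentzFactor m c p
  have hn := norm_le_lorentzFactor hm hc p
  have hpos : 0 < m * lorentzFactor m c p := by positivity
  rw [velocity, norm_smul, Real.norm_of_nonneg (by positivity), inv_mul_le_iff₀ hpos]
  linarith

theorem norm_velocity_sub_le (hm : 0 < m) (hc : 0 < c) (p p' : R3) :
    ‖velocity m c p - velocity m c p'‖ ≤ 2 / m * ‖p - p'‖ := by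
  have hγ := one_le_lorentzFactor m c p
  have hγ' := one_le_lorentzFactor m c p'
  have hn' := norm_le_lorentzFactor hm hc p'
  have hl := abs_lorentzFactor_sub_le hm hc p p'
  have hmc : 0 < m * c := by positivity
  rw [le_div_iff₀ hmc] at hl
  simp only [velocity]
  set g := lorentzFactor m c p
  set g' := lorentzFactor m c p'
  -- The change of the Lorentz factor contributes at most another `‖p - p'‖`, whence the factor `2`.
  have e : (m * g)⁻¹ • p - (m * g')⁻¹ • p' = (m * g)⁻¹ • ((p - p') + ((g' - g) / g') • p') := by
    rw [smul_add, smul_sub, smul_smul]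
    have : (m * g)⁻¹ * ((g' - g) / g') = (m * g)⁻¹ - (m * g')⁻¹ := by field_simp
    rw [this, sub_smul]; abel
  have hA : ‖((g' - g) / g') • p'‖ ≤ ‖p - p'‖ := by
    rw [norm_smul, Real.norm_eq_abs, abs_div, abs_of_pos (by positivity : 0 < g'), abs_sub_comm,
      div_mul_eq_mul_div, div_le_iff₀ (by positivity)]
    calc |g - g'| * ‖p'‖ ≤ |g - g'| * (m * c * g') :=
          mul_le_mul_of_nonneg_left hn' (abs_nonneg _)
      _ = |g - g'| * (m * c) * g' := by ring
      _ ≤ ‖p - p'‖ * g' := by gcongr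
  rw [e, norm_smul, Real.norm_of_nonneg (by positivity)]
  have hinv : (m * g)⁻¹ ≤ 1 / m := by
    rw [one_div]
    exact inv_anti₀ hm (by nlinarith)
  calc (m * g)⁻¹ * ‖(p - p') + ((g' - g) / g') • p'‖
      ≤ 1 / m * (‖p - p'‖ + ‖p - p'‖) := by
        refine mul_le_mul hinv ((norm_add_le _ _).trans (by linarith)) (norm_nonneg _)
          (by positivity)
    _ = 2 / m * ‖p - p'‖ := by ring

theorem norm_beta_le (hm : 0 < m) (hc : 0 < c) (p : R3) : ‖beta m c p‖ ≤ 1 := by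
  rw [beta, norm_smul, Real.norm_of_nonneg (by positivity), inv_mul_le_iff₀ hc, mul_one]
  exact norm_velocity_le hm hc p

theorem norm_beta_sub_le (hm : 0 < m) (hc : 0 < c) (p p' : R3) :
    ‖beta m c p - beta m c p'‖ ≤ c⁻¹ * (2 / m) * ‖p - p'‖ := by
  rw [beta, beta, ← smul_sub, norm_smul, Real.norm_of_nonneg (by positivity), mul_assoc]
  exact mul_le_mul_of_nonneg_left (norm_velocity_sub_le hm hc p p') (by positivity)

/-! ### Bounds for the charge density -/

/-- Functions of class `C¹` with compact support are bounded and Lipschitz continuous. -/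
theorem exists_bound_lipschitz {F : Type} [NormedAddCommGroup F] [NormedSpace ℝ F] {f : R3 → F}
    (hf : ContDiff ℝ 1 f) (hc : HasCompactSupport f) :
    ∃ b, 0 ≤ b ∧ (∀ x, ‖f x‖ ≤ b) ∧ ∀ x y, ‖f x - f y‖ ≤ b * ‖x - y‖ := by
  obtain ⟨C, hC⟩ := hf.continuous.bounded_above_of_compact_support hc
  obtain ⟨L, hL⟩ := hf.lipschitzWith_of_hasCompactSupport hc (by simp)
  refine ⟨max C L, (L.2).trans (le_max_right _ _), fun x => (hC x).trans (le_max_left _ _),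
    fun x y => (hL.norm_sub_le x y).trans ?_⟩
  exact mul_le_mul_of_nonneg_right (le_max_right _ _) (norm_nonneg _)

theorem SmearedDelta.exists_bound (D : SmearedDelta) :
    ∃ b, 0 ≤ b ∧ (∀ x, ‖D.φ x‖ ≤ b) ∧ (∀ x y, ‖D.φ x - D.φ y‖ ≤ b * ‖x - y‖) ∧
      (∀ x, ‖gradient D.φ x‖ ≤ b) ∧ ∀ x y, ‖gradient D.φ x - gradient D.φ y‖ ≤ b * ‖x - y‖ := by
  obtain ⟨b, hb0, hb, hl⟩ := exists_bound_lipschitz (D.contDiff.of_le (by norm_num))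
    D.hasCompactSupport
  have hg : ContDiff ℝ 1 (gradient D.φ) :=
    (InnerProductSpace.toDual ℝ R3).symm.contDiff.comp
      (D.contDiff.fderiv_right (m := 1) (by norm_num))
  obtain ⟨b', hb0', hb', hl'⟩ := exists_bound_lipschitz hg
    (hasCompactSupport_gradient D.hasCompactSupport)
  have h1 := le_max_left b b'
  have h2 := le_max_right b b'
  exact ⟨max b b', hb0.trans h1, fun x => (hb x).trans h1,
    fun x y => (hl x y).trans (mul_le_mul_of_nonneg_right h1 (norm_nonneg _)),
    fun x => (hb' x).trans h2,
    fun x y => (hl' x y).trans (mul_le_mul_of_nonneg_right h2 (norm_nonneg _))⟩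

variable {q : ℝ}

/-! ### The current and the force -/

/-- The bound is uniform over all positions and momenta because `φ` is bounded and speeds do not
exceed `c`; this makes the later field estimate independent of the trajectory. -/
theorem exists_current_bound [IsFiniteMeasure (vol Ω)] (D : SmearedDelta) (hm : 0 < m)
    (hc : 0 < c) (q : ℝ) : ∃ J, 0 ≤ J ∧ (∀ r p, ‖current Ω D q m c r p‖ ≤ J) ∧
      ∀ r p r' p', ‖current Ω D q m c r p - current Ω D q m c r' p'‖ ≤
        J * (‖r - r'‖ + ‖p - p'‖) := by
  obtain ⟨b, hb0, hb, hl, -, -⟩ := D.exists_bound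
  set s : ℝ := measureUnivNNReal (vol Ω) ^ (2 : ENNReal).toReal⁻¹ with hs
  have hs0 : 0 ≤ s := by positivity
  have hJ1 : 0 ≤ |q| * b * c := by positivity
  have hJ2 : 0 ≤ |q| * b * (2 / m) := by positivity
  refine ⟨s * (|q| * b * c + |q| * b * (2 / m)), by positivity, fun r p => ?_,
    fun r p r' p' => ?_⟩
  · rw [current, WithLp.norm_toLp_fst]
    refine (Lp.norm_le_of_ae_bound hJ1 ?_).trans (mul_le_mul_of_nonneg_left (by linarith) hs0)
    filter_upwards [(D.memLp Ω (-q) r (velocity m c p)).coeFn_toLp] with x hx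
    rw [hx, norm_smul, norm_mul, norm_neg, Real.norm_eq_abs q]
    exact mul_le_mul (mul_le_mul_of_nonneg_left (hb _) (abs_nonneg _)) (norm_velocity_le hm hc p)
      (norm_nonneg _) (by positivity)
  · have e : current Ω D q m c r p - current Ω D q m c r' p' = WithLp.toLp 2
        (((D.memLp Ω (-q) r (velocity m c p)).sub (D.memLp Ω (-q) r' (velocity m c p'))).toLp,
          (0 : X Ω)) := by
      rw [MemLp.toLp_sub, current, current, ← WithLp.toLp_sub, Prod.mk_sub_mk, sub_zero]
    rw [e, WithLp.norm_toLp_fst, mul_assoc]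
    have hn : 0 ≤ ‖r - r'‖ := norm_nonneg _
    have hn' : 0 ≤ ‖p - p'‖ := norm_nonneg _
    refine Lp.norm_le_of_ae_bound (by positivity) ?_
    filter_upwards [((D.memLp Ω (-q) r (velocity m c p)).sub
      (D.memLp Ω (-q) r' (velocity m c p'))).coeFn_toLp] with x hx
    rw [hx, Pi.sub_apply]
    have e2 : (-q * D.φ (x - r)) • velocity m c p - (-q * D.φ (x - r')) • velocity m c p' =
        (-q * (D.φ (x - r) - D.φ (x - r'))) • velocity m c p +
        (-q * D.φ (x - r')) • (velocity m c p - velocity m c p') := by module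
    have h1 : ‖D.φ (x - r) - D.φ (x - r')‖ ≤ b * ‖r - r'‖ := by
      have := hl (x - r) (x - r')
      rwa [sub_sub_sub_cancel_left, norm_sub_rev r'] at this
    rw [e2]
    refine (norm_add_le _ _).trans ?_
    rw [norm_smul, norm_smul, norm_mul, norm_mul, norm_neg, Real.norm_eq_abs q]
    have h2 : |q| * ‖D.φ (x - r) - D.φ (x - r')‖ * ‖velocity m c p‖ ≤
        |q| * (b * ‖r - r'‖) * c :=
      mul_le_mul (mul_le_mul_of_nonneg_left h1 (abs_nonneg _)) (norm_velocity_le hm hc p)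
        (norm_nonneg _) (by positivity)
    have h3 : |q| * ‖D.φ (x - r')‖ * ‖velocity m c p - velocity m c p'‖ ≤
        |q| * b * (2 / m * ‖p - p'‖) :=
      mul_le_mul (mul_le_mul_of_nonneg_left (hb _) (abs_nonneg _)) (norm_velocity_sub_le hm hc p p')
        (norm_nonneg _) (by positivity)
    nlinarith [mul_nonneg hJ1 hn', mul_nonneg hJ2 hn]

/-- Multiplication of vectors by scalars as a continuous bilinear map. -/
abbrev scalarMul : ℝ →L[ℝ] R3 →L[ℝ] R3 := ContinuousLinearMap.lsmul ℝ ℝ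

theorem norm_scalarMul_le (k : ℝ) (f : R3) : ‖scalarMul k f‖ ≤ ‖k‖ * ‖f‖ :=
  (norm_smul k f).le

theorem norm_scalarMul_flip_le (k : R3) (f : ℝ) : ‖scalarMul.flip k f‖ ≤ ‖k‖ * ‖f‖ :=
  (norm_smul f k).le.trans (mul_comm _ _).le

/-- Pulling `β(p)` out of the integrals separates the two dependences: momentum enters only through
cross products, position only through kernels that are Lipschitz in `r`. -/
theorem force_eq [IsFiniteMeasure (vol Ω)] [IsFiniteMeasure (surf Ω)] (D : SmearedDelta)
    {b b' b'' : ℝ} (h₀ : IsLipKernel (vol Ω) (fun r x => D.φ (x - r)) b)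
    (h₁ : IsLipKernel (vol Ω) (fun r x => gradient D.φ (x - r)) b')
    (h₂ : IsLipKernel (surf Ω) (fun r x => D.φ (x - r) • outwardNormal Ω x) b'')
    (u : L2Γ Ω) (η : L2 Ω) (V : XX Ω) (r p : R3) :
    force Ω D q m c u η V r p =
      q • ((∫ x, scalarMul (D.φ (x - r)) (V.fst x) ∂(vol Ω)) +
        cross (beta m c p) (∫ x, scalarMul (D.φ (x - r)) (V.snd x) ∂(vol Ω)) -
        cross (∫ x, scalarMul.flip (gradient D.φ (x - r)) (η x) ∂(vol Ω)) (beta m c p) +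
        cross (beta m c p)
          (∫ x, scalarMul.flip (D.φ (x - r) • outwardNormal Ω x) (u x) ∂(surf Ω))) := by
  have i₀ := fun f : X Ω => integrable_of_norm_le scalarMul norm_scalarMul_le (h₀.meas r)
    (h₀.bound r) f
  have i₁ := integrable_of_norm_le scalarMul.flip norm_scalarMul_flip_le (h₁.meas r)
    (h₁.bound r) η
  have i₂ := integrable_of_norm_le scalarMul.flip norm_scalarMul_flip_le (h₂.meas r)
    (h₂.bound r) u
  rw [force, smul_add, smul_sub]
  congr 2
  · congr 1
    rw [← crossL_apply, ← ContinuousLinearMap.integral_comp_comm _ (i₀ V.snd),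
      ← integral_add (i₀ V.fst) ((crossL (beta m c p)).integrable_comp (i₀ V.snd))]
    refine integral_congr_ae (Eventually.of_forall fun x => ?_)
    simp [← crossL_apply]
  · congr 1
    rw [← crossL_apply, ← ContinuousLinearMap.flip_apply,
      ← ContinuousLinearMap.integral_comp_comm _ i₁]
    refine integral_congr_ae (Eventually.of_forall fun x => ?_)
    simp [← crossL_apply]
  · rw [← crossL_apply, ← ContinuousLinearMap.integral_comp_comm _ i₂]
    refine integral_congr_ae (Eventually.of_forall fun x => ?_)
    simp [← crossL_apply, smul_smul, mul_comm]

theorem SmearedDelta.exists_isLipKernel (D : SmearedDelta) (Ω : Set R3) : ∃ b, 0 ≤ b ∧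
    IsLipKernel (vol Ω) (fun r x => D.φ (x - r)) b ∧
    IsLipKernel (vol Ω) (fun r x => gradient D.φ (x - r)) b ∧
    IsLipKernel (surf Ω) (fun r x => D.φ (x - r) • outwardNormal Ω x) b := by
  obtain ⟨b, hb0, hb, hl, hgb, hgl⟩ := D.exists_bound
  have hshift : ∀ x r r' : R3, b * ‖(x - r) - (x - r')‖ = b * ‖r - r'‖ := fun x r r' => by
    rw [sub_sub_sub_cancel_left, norm_sub_rev]
  have hcont : ∀ r : R3, Continuous (fun x => x - r) := fun r => by fun_prop
  have hφ : ∀ r : R3, Continuous (fun x => D.φ (x - r)) := fun r =>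
    D.contDiff.continuous.comp (hcont r)
  have hgc : Continuous (gradient D.φ) := continuous_gradient (D.contDiff.of_le (by norm_num))
  refine ⟨b, hb0, ⟨fun r => (hφ r).aestronglyMeasurable, fun r x => hb _,
      fun r r' x => (hl _ _).trans_eq (hshift x r r')⟩,
    ⟨fun r => (hgc.comp (hcont r)).aestronglyMeasurable, fun r x => hgb _,
      fun r r' x => (hgl _ _).trans_eq (hshift x r r')⟩,
    ⟨fun r => (hφ r).aestronglyMeasurable.smul measurable_outwardNormal.aestronglyMeasurable,
      fun r x => ?_, fun r r' x => ?_⟩⟩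
  · rw [norm_smul, ← mul_one b]
    exact mul_le_mul (hb _) (norm_outwardNormal_le x) (norm_nonneg _) hb0
  · rw [← sub_smul, norm_smul, ← mul_one (b * _)]
    exact mul_le_mul ((hl _ _).trans_eq (hshift x r r')) (norm_outwardNormal_le x) (norm_nonneg _)
      (by positivity)

theorem norm_lorentz_le {β I₁ I₂ I₃ I₄ : R3} {a v e u : ℝ} (hβ : ‖β‖ ≤ 1) (h₁ : ‖I₁‖ ≤ a * v)
    (h₂ : ‖I₂‖ ≤ a * v) (h₃ : ‖I₃‖ ≤ a * e) (h₄ : ‖I₄‖ ≤ a * u) :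
    ‖I₁ + cross β I₂ - cross I₃ β + cross β I₄‖ ≤ a * v + a * v + a * e + a * u := by
  have c2 := (norm_cross_le β I₂).trans (mul_le_of_le_one_left (norm_nonneg _) hβ)
  have c3 := (norm_cross_le I₃ β).trans (mul_le_of_le_one_right (norm_nonneg _) hβ)
  have c4 := (norm_cross_le β I₄).trans (mul_le_of_le_one_left (norm_nonneg _) hβ)
  refine (norm_add_le _ _).trans (add_le_add ?_ (c4.trans h₄))
  refine (norm_sub_le _ _).trans (add_le_add ?_ (c3.trans h₃))
  exact (norm_add_le _ _).trans (add_le_add h₁ (c2.trans h₂))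

theorem norm_lorentz_sub_le {β β' I₁ I₂ I₃ I₄ I₁' I₂' I₃' I₄' : R3}
    {a v e u l d₁ d₂ d₃ d₄ : ℝ} (hβ : ‖β'‖ ≤ 1) (hl : ‖β - β'‖ ≤ l)
    (h₂ : ‖I₂‖ ≤ a * v) (h₃ : ‖I₃‖ ≤ a * e) (h₄ : ‖I₄‖ ≤ a * u) (hd₁ : ‖I₁ - I₁'‖ ≤ d₁)
    (hd₂ : ‖I₂ - I₂'‖ ≤ d₂) (hd₃ : ‖I₃ - I₃'‖ ≤ d₃) (hd₄ : ‖I₄ - I₄'‖ ≤ d₄) :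
    ‖I₁ + cross β I₂ - cross I₃ β + cross β I₄ -
      (I₁' + cross β' I₂' - cross I₃' β' + cross β' I₄')‖ ≤
      d₁ + (l * (a * v) + d₂) + (l * (a * e) + d₃) + (l * (a * u) + d₄) := by
  have hl0 : 0 ≤ l := (norm_nonneg _).trans hl
  have hleft : ∀ (I I' : R3) (x y : ℝ), ‖I‖ ≤ x → ‖I - I'‖ ≤ y →
      ‖cross β I - cross β' I'‖ ≤ l * x + y := by
    intro I I' x y hx hy
    refine (norm_cross_sub_le _ _ _ _).trans (add_le_add ?_ ?_)
    · exact mul_le_mul hl hx (norm_nonneg _) hl0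
    · exact (mul_le_of_le_one_left (norm_nonneg _) hβ).trans hy
  have hanti : ∀ v w : R3, cross v w = -cross w v := fun v w => by
    ext i; fin_cases i <;> simp [cross_apply_eq] <;> ring
  have c2 := hleft I₂ I₂' _ _ h₂ hd₂
  have c3 := hleft I₃ I₃' _ _ h₃ hd₃
  have c4 := hleft I₄ I₄' _ _ h₄ hd₄
  rw [hanti I₃ β, hanti I₃' β']
  have e : I₁ + cross β I₂ - -cross β I₃ + cross β I₄ -
      (I₁' + cross β' I₂' - -cross β' I₃' + cross β' I₄') =
      (I₁ - I₁') + (cross β I₂ - cross β' I₂') + (cross β I₃ - cross β' I₃') +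
        (cross β I₄ - cross β' I₄') := by abel
  rw [e]
  refine (norm_add_le _ _).trans (add_le_add ?_ c4)
  refine (norm_add_le _ _).trans (add_le_add ?_ c3)
  exact (norm_add_le _ _).trans (add_le_add hd₁ c2)

/-- The constant depends on neither the control nor the fields; their sizes appear as explicit
factors. The first bound yields the affine estimate in `‖u‖`, the second the Lipschitz property of
the right-hand side. -/
theorem exists_force_bound [IsFiniteMeasure (vol Ω)] [IsFiniteMeasure (surf Ω)] (D : SmearedDelta)
    (hm : 0 < m) (hc : 0 < c) (q : ℝ) : ∃ A, 0 ≤ A ∧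
      (∀ (u : L2Γ Ω) (η : L2 Ω) (V : XX Ω) (r p : R3),
        ‖force Ω D q m c u η V r p‖ ≤ A * (‖V‖ + ‖η‖ + ‖u‖)) ∧
      ∀ (u : L2Γ Ω) (η : L2 Ω) (V V' : XX Ω) (r p r' p' : R3),
        ‖force Ω D q m c u η V r p - force Ω D q m c u η V' r' p'‖ ≤
          A * (‖V - V'‖ + (‖V‖ + ‖η‖ + ‖u‖) * (‖r - r'‖ + ‖p - p'‖)) := by
  obtain ⟨b, hb0, h₀, h₁, h₂⟩ := D.exists_isLipKernel Ω
  obtain ⟨a, ha0, has, has'⟩ : ∃ a, 0 ≤ a ∧ b * (vol Ω univ ^ (1 / 2 : ℝ)).toReal ≤ a ∧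
      b * (surf Ω univ ^ (1 / 2 : ℝ)).toReal ≤ a :=
    ⟨_, le_max_of_le_left (mul_nonneg hb0 ENNReal.toReal_nonneg), le_max_left _ _, le_max_right _ _⟩
  have hk0 : 0 ≤ c⁻¹ * (2 / m) := by positivity
  have hβl := norm_beta_sub_le hm hc
  generalize c⁻¹ * (2 / m) = k at hk0 hβl
  have M₁ := fun r (f : X Ω) => (h₀.norm_integral_le scalarMul norm_scalarMul_le r f).trans
    (mul_le_mul_of_nonneg_right has (norm_nonneg _))
  have M₂ := fun r r' (f f' : X Ω) =>
    (h₀.norm_integral_sub_le scalarMul norm_scalarMul_le r r' f f').trans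
      (mul_le_mul_of_nonneg_right has (by positivity))
  have N₁ := fun r (f : L2 Ω) =>
    (h₁.norm_integral_le scalarMul.flip norm_scalarMul_flip_le r f).trans
      (mul_le_mul_of_nonneg_right has (norm_nonneg _))
  have N₂ := fun r r' (f f' : L2 Ω) =>
    (h₁.norm_integral_sub_le scalarMul.flip norm_scalarMul_flip_le r r' f f').trans
      (mul_le_mul_of_nonneg_right has (by positivity))
  have K₁ := fun r (f : L2Γ Ω) =>
    (h₂.norm_integral_le scalarMul.flip norm_scalarMul_flip_le r f).trans
      (mul_le_mul_of_nonneg_right has' (norm_nonneg _))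
  have K₂ := fun r r' (f f' : L2Γ Ω) =>
    (h₂.norm_integral_sub_le scalarMul.flip norm_scalarMul_flip_le r r' f f').trans
      (mul_le_mul_of_nonneg_right has' (by positivity))
  have hfst : ∀ V : XX Ω, ‖V.fst‖ ≤ ‖V‖ := fun V => WithLp.norm_fst_le _ V
  have hsnd : ∀ V : XX Ω, ‖V.snd‖ ≤ ‖V‖ := fun V => WithLp.norm_snd_le _ V
  have B₁ := fun r (V : XX Ω) => (M₁ r V.fst).trans (mul_le_mul_of_nonneg_left (hfst V) ha0)
  have B₂ := fun r (V : XX Ω) => (M₁ r V.snd).trans (mul_le_mul_of_nonneg_left (hsnd V) ha0)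
  refine ⟨|q| * (2 * a * (1 + k)), by positivity, fun u η V r p => ?_,
    fun u η V V' r p r' p' => ?_⟩
  · rw [force_eq D h₀ h₁ h₂, norm_smul, Real.norm_eq_abs, mul_assoc]
    refine mul_le_mul_of_nonneg_left ((norm_lorentz_le (norm_beta_le hm hc p) (B₁ r V) (B₂ r V)
      (N₁ r η) (K₁ r u)).trans ?_) (abs_nonneg _)
    have hX : 0 ≤ a * ‖η‖ + a * ‖u‖ := by positivity
    have hY : 0 ≤ 2 * a * k * (‖V‖ + ‖η‖ + ‖u‖) := by positivity
    linear_combination hX + hY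
  · rw [force_eq D h₀ h₁ h₂, force_eq D h₀ h₁ h₂, ← smul_sub, norm_smul, Real.norm_eq_abs,
      mul_assoc]
    have t1 := (M₂ r r' V.fst V'.fst).trans (mul_le_mul_of_nonneg_left
      (add_le_add (mul_le_mul_of_nonneg_left (hfst V) (norm_nonneg _)) (hfst (V - V'))) ha0)
    have t2 := (M₂ r r' V.snd V'.snd).trans (mul_le_mul_of_nonneg_left
      (add_le_add (mul_le_mul_of_nonneg_left (hsnd V) (norm_nonneg _)) (hsnd (V - V'))) ha0)
    refine mul_le_mul_of_nonneg_left ((norm_lorentz_sub_le (norm_beta_le hm hc p') (hβl p p')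
      (B₂ r V) (N₁ r η) (K₁ r u) t1 t2 (N₂ r r' η η) (K₂ r r' u u)).trans ?_) (abs_nonneg _)
    rw [sub_self, sub_self, norm_zero, norm_zero]
    have y1 : 0 ≤ a * ‖r - r'‖ * (‖η‖ + ‖u‖) := by positivity
    have y2 : 0 ≤ a * k * ‖V - V'‖ := by positivity
    have y3 : 0 ≤ a * k * ‖p - p'‖ * (‖V‖ + ‖η‖ + ‖u‖) := by positivity
    have y4 : 0 ≤ a * k * ‖r - r'‖ * (‖V‖ + ‖η‖ + ‖u‖) := by positivity
    have y5 : 0 ≤ a * ‖p - p'‖ * (‖V‖ + ‖η‖ + ‖u‖) := by positivity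
    linear_combination y1 + 2 * y2 + y3 + 2 * y4 + 2 * y5

/-! ### Duhamel's formula -/

section Duhamel

variable {H : Type} [NormedAddCommGroup H] [InnerProductSpace ℝ H] [CompleteSpace H]
  {A : Submodule ℝ (H × H)}

theorem IsMaximalSkew.continuous_uncurry_semigroup (hA : IsMaximalSkew A) :
    Continuous (fun p : ℝ × H => hA.semigroup p.1 p.2) := by
  rw [continuous_iff_continuousAt]
  rintro ⟨t, f⟩
  have h1 : Tendsto (fun p : ℝ × H => hA.semigroup p.1 f) (𝓝 (t, f)) (𝓝 (hA.semigroup t f)) :=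
    ((hA.continuous_semigroup f).comp continuous_fst).tendsto (t, f)
  have h2 : Tendsto (fun p : ℝ × H => hA.semigroup p.1 (p.2 - f)) (𝓝 (t, f)) (𝓝 0) := by
    refine squeeze_zero_norm (fun p => hA.norm_semigroup_le _ _) ?_
    have : Continuous (fun p : ℝ × H => ‖p.2 - f‖) := by fun_prop
    simpa using this.tendsto (t, f)
  simpa [ContinuousAt] using h1.add h2

/-- The mild solution with initial value `V₀` and right-hand side `j`. -/
def IsMaximalSkew.duhamel (hA : IsMaximalSkew A) (V₀ : H) (j : ℝ → H) (t : ℝ) : H :=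
  hA.semigroup t V₀ + ∫ τ in (0 : ℝ)..t, hA.semigroup (t - τ) (j τ)

theorem IsMaximalSkew.continuous_duhamel_integrand (hA : IsMaximalSkew A) {j : ℝ → H}
    (hj : Continuous j) : Continuous (fun p : ℝ × ℝ => hA.semigroup (p.1 - p.2) (j p.2)) := by
  have hg : Continuous (fun p : ℝ × ℝ => (p.1 - p.2, j p.2)) := by fun_prop
  simpa only [Function.comp_def] using hA.continuous_uncurry_semigroup.comp hg

theorem IsMaximalSkew.intervalIntegrable_duhamel (hA : IsMaximalSkew A) {j : ℝ → H}
    (hj : Continuous j) (t a b : ℝ) :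
    IntervalIntegrable (fun τ => hA.semigroup (t - τ) (j τ)) volume a b :=
  ((hA.continuous_duhamel_integrand hj).comp
    (continuous_const.prodMk continuous_id)).intervalIntegrable _ _

theorem IsMaximalSkew.continuous_duhamel (hA : IsMaximalSkew A) (V₀ : H) {j : ℝ → H}
    (hj : Continuous j) : Continuous (hA.duhamel V₀ j) :=
  (hA.continuous_semigroup V₀).add
    (intervalIntegral.continuous_parametric_intervalIntegral_of_continuous
      (hA.continuous_duhamel_integrand hj) continuous_id)

/-- Contractivity of the semigroup keeps the bound free of growth factors. -/
theorem IsMaximalSkew.norm_duhamel_le (hA : IsMaximalSkew A) (V₀ : H) {j : ℝ → H} {J : ℝ}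
    (hJ : ∀ t, ‖j t‖ ≤ J) {T t : ℝ} (ht : t ∈ Icc 0 T) :
    ‖hA.duhamel V₀ j t‖ ≤ ‖V₀‖ + J * T := by
  have hJ0 : 0 ≤ J := (norm_nonneg _).trans (hJ 0)
  refine (norm_add_le _ _).trans (add_le_add (hA.norm_semigroup_le _ _) ?_)
  refine (intervalIntegral.norm_integral_le_of_norm_le_const
    fun τ _ => (hA.norm_semigroup_le _ _).trans (hJ τ)).trans ?_
  rw [sub_zero, abs_of_nonneg ht.1]
  exact mul_le_mul_of_nonneg_left ht.2 hJ0

theorem IsMaximalSkew.norm_duhamel_sub_le (hA : IsMaximalSkew A) (V₀ : H) {j j' : ℝ → H}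
    (hj : Continuous j) (hj' : Continuous j') {d T t : ℝ} (ht : t ∈ Icc 0 T)
    (hd : ∀ τ ∈ Icc 0 t, ‖j τ - j' τ‖ ≤ d) :
    ‖hA.duhamel V₀ j t - hA.duhamel V₀ j' t‖ ≤ d * T := by
  have hd0 : 0 ≤ d := (norm_nonneg _).trans (hd 0 ⟨le_rfl, ht.1⟩)
  rw [duhamel, duhamel, add_sub_add_left_eq_sub,
    ← intervalIntegral.integral_sub (hA.intervalIntegrable_duhamel hj _ _ _)
      (hA.intervalIntegrable_duhamel hj' _ _ _)]
  refine (intervalIntegral.norm_integral_le_of_norm_le_const (C := d) fun τ hτ => ?_).trans ?_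
  · rw [uIoc_of_le ht.1] at hτ
    rw [← map_sub]
    exact (hA.norm_semigroup_le _ _).trans (hd τ ⟨hτ.1.le, hτ.2⟩)
  · rw [sub_zero, abs_of_nonneg ht.1]
    exact mul_le_mul_of_nonneg_left ht.2 hd0

end Duhamel

/-! ### The reduced state system -/

variable {T : ℝ}

/-- The electromagnetic fields generated by the trajectory `y`. -/
def fields (hA : IsMaximalSkew (maxwellGraph Ω)) (D : SmearedDelta) (q m c : ℝ) (r₀ p₀ : R3)
    (V₀ : XX Ω) (y : ℝ → R3 × R3) : ℝ → XX Ω :=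
  hA.duhamel V₀ fun t => current Ω D q m c ((y t).1 + r₀) ((y t).2 + p₀)

/-- The right-hand side of the reduced state system. -/
def stateRhs (hA : IsMaximalSkew (maxwellGraph Ω)) (D : SmearedDelta) (q m c : ℝ) (r₀ p₀ : R3)
    (V₀ : XX Ω) (u : L2Γ Ω) (η : L2 Ω) (y : ℝ → R3 × R3) (t : ℝ) : R3 × R3 :=
  (velocity m c ((y t).2 + p₀),
    force Ω D q m c u η (fields hA D q m c r₀ p₀ V₀ y t) ((y t).1 + r₀) ((y t).2 + p₀))

theorem continuous_current [IsFiniteMeasure (vol Ω)] (D : SmearedDelta) (hm : 0 < m) (hc : 0 < c)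
    (q : ℝ) {r p : ℝ → R3} (hr : Continuous r) (hp : Continuous p) :
    Continuous (fun t => current Ω D q m c (r t) (p t)) := by
  obtain ⟨J, -, -, hJ⟩ := exists_current_bound (Ω := Ω) D hm hc q
  rw [continuous_iff_continuousAt]
  intro t
  rw [ContinuousAt, tendsto_iff_norm_sub_tendsto_zero]
  refine squeeze_zero (fun _ => norm_nonneg _) (fun s => hJ _ _ _ _) ?_
  have : Continuous (fun s => J * (‖r s - r t‖ + ‖p s - p t‖)) := by fun_prop
  simpa using this.tendsto t

theorem continuous_force [IsFiniteMeasure (vol Ω)] [IsFiniteMeasure (surf Ω)] (D : SmearedDelta)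
    (hm : 0 < m) (hc : 0 < c) (q : ℝ) (u : L2Γ Ω) (η : L2 Ω) {V : ℝ → XX Ω} {r p : ℝ → R3}
    (hV : Continuous V) (hr : Continuous r) (hp : Continuous p) :
    Continuous (fun t => force Ω D q m c u η (V t) (r t) (p t)) := by
  obtain ⟨A, -, -, hA⟩ := exists_force_bound (Ω := Ω) D hm hc q
  rw [continuous_iff_continuousAt]
  intro t
  rw [ContinuousAt, tendsto_iff_norm_sub_tendsto_zero]
  refine squeeze_zero (fun _ => norm_nonneg _)
    (fun s => (norm_sub_rev _ _).trans_le (hA u η (V t) (V s) (r t) (p t) (r s) (p s))) ?_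
  have : Continuous (fun s => A * (‖V t - V s‖ + (‖V t‖ + ‖η‖ + ‖u‖) *
    (‖r t - r s‖ + ‖p t - p s‖))) := by fun_prop
  simpa using this.tendsto t

theorem continuous_velocity (hm : 0 < m) (hc : 0 < c) : Continuous (velocity m c) :=
  (LipschitzWith.of_dist_le' fun p p' => by
    rw [dist_eq_norm, dist_eq_norm]; exact norm_velocity_sub_le hm hc p p').continuous

/-- The fields at `t` see only the current on `[0,t]`, which gives causality, and they are bounded
uniformly in the trajectory, which makes the Lipschitz constant global. It may depend on `u` and
`η`, since it serves only solvability and uniqueness. -/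
theorem exists_isCausal_stateRhs [IsFiniteMeasure (vol Ω)] [IsFiniteMeasure (surf Ω)]
    (hA : IsMaximalSkew (maxwellGraph Ω)) (D : SmearedDelta) (hm : 0 < m) (hc : 0 < c)
    (hT : 0 ≤ T) (q : ℝ) (r₀ p₀ : R3) (V₀ : XX Ω) (u : L2Γ Ω) (η : L2 Ω) :
    ∃ L, 0 ≤ L ∧ IsCausal T L (stateRhs hA D q m c r₀ p₀ V₀ u η) := by
  obtain ⟨J, hJ0, hJ, hJl⟩ := exists_current_bound (Ω := Ω) D hm hc q
  obtain ⟨A, hA0, -, hAl⟩ := exists_force_bound (Ω := Ω) D hm hc q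
  have hcur : ∀ y : ℝ → R3 × R3, Continuous y →
      Continuous fun t => current Ω D q m c ((y t).1 + r₀) ((y t).2 + p₀) := fun y hy =>
    continuous_current D hm hc q (by fun_prop) (by fun_prop)
  have hV : ∀ y : ℝ → R3 × R3, Continuous y → Continuous (fields hA D q m c r₀ p₀ V₀ y) :=
    fun y hy => hA.continuous_duhamel V₀ (hcur y hy)
  have hN0 : 0 ≤ ‖V₀‖ + J * T + ‖η‖ + ‖u‖ := by positivity
  refine ⟨2 / m + A * (J * 2 * T + (‖V₀‖ + J * T + ‖η‖ + ‖u‖) * 2), by positivity,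
    fun y hy => ?_, fun y y' hy hy' t ht b hb => ?_⟩
  · exact ((continuous_velocity hm hc).comp (by fun_prop)).prodMk
      (continuous_force D hm hc q u η (hV y hy) (by fun_prop) (by fun_prop))
  · have hb0 : 0 ≤ b := (norm_nonneg _).trans (hb 0 ⟨le_rfl, ht.1⟩)
    have hw : ∀ s ∈ Icc 0 t, ‖((y s).1 + r₀) - ((y' s).1 + r₀)‖ ≤ b := fun s hs => by
      rw [add_sub_add_right_eq_sub]; exact (norm_fst_le (y s - y' s)).trans (hb s hs)
    have hz : ∀ s ∈ Icc 0 t, ‖((y s).2 + p₀) - ((y' s).2 + p₀)‖ ≤ b := fun s hs => by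
      rw [add_sub_add_right_eq_sub]; exact (norm_snd_le (y s - y' s)).trans (hb s hs)
    have htt : t ∈ Icc 0 t := ⟨ht.1, le_rfl⟩
    have h1 : ‖fields hA D q m c r₀ p₀ V₀ y t - fields hA D q m c r₀ p₀ V₀ y' t‖ ≤
        J * (b + b) * T :=
      hA.norm_duhamel_sub_le V₀ (hcur y hy) (hcur y' hy') ht fun τ hτ =>
        (hJl _ _ _ _).trans (mul_le_mul_of_nonneg_left (add_le_add (hw τ hτ) (hz τ hτ)) hJ0)
    have h2 : ‖fields hA D q m c r₀ p₀ V₀ y t‖ ≤ ‖V₀‖ + J * T :=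
      hA.norm_duhamel_le V₀ (fun _ => hJ _ _) ht
    have hforce := (hAl u η (fields hA D q m c r₀ p₀ V₀ y t) (fields hA D q m c r₀ p₀ V₀ y' t)
      ((y t).1 + r₀) ((y t).2 + p₀) ((y' t).1 + r₀) ((y' t).2 + p₀)).trans
      (mul_le_mul_of_nonneg_left (add_le_add h1 (mul_le_mul
        (add_le_add (add_le_add h2 le_rfl) le_rfl) (add_le_add (hw t htt) (hz t htt))
        (by positivity) hN0)) hA0)
    have hvel := (norm_velocity_sub_le hm hc ((y t).2 + p₀) ((y' t).2 + p₀)).trans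
      (mul_le_mul_of_nonneg_left (hz t htt) (by positivity))
    have hX : 0 ≤ A * (J * 2 * T + (‖V₀‖ + J * T + ‖η‖ + ‖u‖) * 2) * b := by positivity
    have hY : 0 ≤ 2 / m * b := by positivity
    -- The product carries the maximum norm, so the sum of the two Lipschitz constants covers both
    -- components.
    refine norm_prod_le_iff.2 ⟨hvel.trans ?_, hforce.trans ?_⟩
    · linear_combination hX
    · linear_combination hY

theorem isReducedSolution_of_hasDerivAt (hA : IsMaximalSkew (maxwellGraph Ω))
    [IsFiniteMeasure (vol Ω)] (hT : 0 < T) (D : SmearedDelta) (hm : 0 < m) (hc : 0 < c)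
    {r₀ p₀ : R3} {E₀ B₀ : X Ω} {u : L2Γ Ω} {η : L2 Ω} (hη : IsVeryWeakSolution Ω u η)
    {Y f : ℝ → R3 × R3} (hf : Continuous f) (hY : ∀ t, HasDerivAt Y (f t) t) (hY0 : Y 0 = 0)
    (hfY : EqOn f (stateRhs hA D q m c r₀ p₀ (WithLp.toLp 2 (E₀, B₀)) u η Y) (Icc 0 T)) :
    IsReducedSolution Ω T D q m c r₀ p₀ E₀ B₀ u (fun t => (Y t).1) (fun t => (Y t).2) := by
  have hYc : Continuous Y := continuous_iff_continuousAt.2 fun t => (hY t).continuousAt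
  have hd1 : ∀ t, HasDerivAt (fun t => (Y t).1) (f t).1 t := fun t => (hY t).fst
  have hd2 : ∀ t, HasDerivAt (fun t => (Y t).2) (f t).2 t := fun t => (hY t).snd
  have hu : UniqueDiffOn ℝ (Icc 0 T) := uniqueDiffOn_Icc hT
  refine ⟨⟨?_, by simp [hY0]⟩, ⟨?_, by simp [hY0]⟩,
    fields hA D q m c r₀ p₀ (WithLp.toLp 2 (E₀, B₀)) Y, η,
    ⟨?_, hA.semigroup, isMaxwellSemigroup_semigroup hA, fun t _ => rfl⟩, hη, fun t ht => ⟨?_, ?_⟩⟩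
  · refine (contDiff_one_iff_deriv.2 ⟨fun t => (hd1 t).differentiableAt, ?_⟩).contDiffOn
    rw [show deriv (fun t => (Y t).1) = fun t => (f t).1 from funext fun t => (hd1 t).deriv]
    fun_prop
  · refine (contDiff_one_iff_deriv.2 ⟨fun t => (hd2 t).differentiableAt, ?_⟩).contDiffOn
    rw [show deriv (fun t => (Y t).2) = fun t => (f t).2 from funext fun t => (hd2 t).deriv]
    fun_prop
  · exact (hA.continuous_duhamel _
      (continuous_current D hm hc q (by fun_prop) (by fun_prop))).continuousOn
  · rw [(hd2 t).hasDerivWithinAt.derivWithin (hu t ht), hfY ht]; rfl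
  · rw [(hd1 t).hasDerivWithinAt.derivWithin (hu t ht), hfY ht]; rfl

/-- A continuously differentiable function on `[0,T]` is the integral of its derivative. -/
theorem IsC1Zero.eq_integral (hT : 0 < T) {w : ℝ → R3} (h : IsC1Zero T w) {t : ℝ}
    (ht : t ∈ Icc 0 T) : w t = ∫ s in (0 : ℝ)..t, derivWithin w (Icc 0 T) s := by
  have hsub : Icc 0 t ⊆ Icc 0 T := Icc_subset_Icc le_rfl ht.2
  have hd : ContinuousOn (derivWithin w (Icc 0 T)) (Icc 0 T) :=
    h.1.continuousOn_derivWithin (uniqueDiffOn_Icc hT) le_rfl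
  have := intervalIntegral.integral_eq_sub_of_hasDerivAt_of_le ht.1 (h.1.continuousOn.mono hsub)
    (fun s hs => ?_) (hd.mono (by rw [uIcc_of_le ht.1]; exact hsub)).intervalIntegrable
  · rw [this, h.2, sub_zero]
  · have hs' : s ∈ Ioo 0 T := ⟨hs.1, hs.2.trans_le ht.2⟩
    exact ((h.1.differentiableOn (by simp)) s (Ioo_subset_Icc_self hs')).hasDerivWithinAt.hasDerivAt
      (Icc_mem_nhds hs'.1 hs'.2)

/-- A solution comes with its own semigroup, fields and potential. Uniqueness of each identifies
them with the canonical ones, so that any two solutions satisfy the same integral equation. -/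
theorem IsReducedSolution.exists_integral_eq (hA : IsMaximalSkew (maxwellGraph Ω)) (hT : 0 < T)
    {D : SmearedDelta} {r₀ p₀ : R3} {E₀ B₀ : X Ω} {u : L2Γ Ω}
    {η : L2 Ω} (hη : ∀ η', IsVeryWeakSolution Ω u η' → η' = η) {w z : ℝ → R3}
    (h : IsReducedSolution Ω T D q m c r₀ p₀ E₀ B₀ u w z) :
    ∃ y : ℝ → R3 × R3, Continuous y ∧ (∀ t ∈ Icc 0 T, y t = (w t, z t)) ∧
      ∀ t ∈ Icc 0 T, y t = ∫ s in (0 : ℝ)..t,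
        stateRhs hA D q m c r₀ p₀ (WithLp.toLp 2 (E₀, B₀)) u η y s := by
  obtain ⟨hw, hz, V, η', ⟨hVc, G, hG, hV⟩, hη', hode⟩ := h
  obtain rfl := hη η' hη'
  have hcont : ContinuousOn (fun t => (w t, z t)) (Icc 0 T) :=
    hw.1.continuousOn.prodMk hz.1.continuousOn
  -- Outside `[0,T]` the given functions are arbitrary; the constant extension is globally
  -- continuous.
  set y : ℝ → R3 × R3 := IccExtend hT.le ((Icc 0 T).domRestrict fun t => (w t, z t)) with hy
  have hyc : Continuous y := (continuousOn_iff_continuous_domRestrict.1 hcont).Icc_extend'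
  have hye : ∀ t ∈ Icc 0 T, y t = (w t, z t) := fun t ht => by
    rw [hy, IccExtend_of_mem hT.le _ ht]; rfl
  refine ⟨y, hyc, hye, fun t ht => ?_⟩
  have hfields : ∀ s ∈ Icc 0 T, V s = fields hA D q m c r₀ p₀ (WithLp.toLp 2 (E₀, B₀)) y s := by
    intro s hs
    rw [hV s hs, fields, IsMaximalSkew.duhamel, hG.eq_semigroup hA hs.1]
    congr 1
    refine intervalIntegral.integral_congr fun τ hτ => ?_
    rw [uIcc_of_le hs.1] at hτ
    dsimp only
    rw [hG.eq_semigroup hA (sub_nonneg.2 hτ.2), hye τ ⟨hτ.1, hτ.2.trans hs.2⟩]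
  have hrhs : ∀ s ∈ Icc 0 T, stateRhs hA D q m c r₀ p₀ (WithLp.toLp 2 (E₀, B₀)) u η' y s =
      (derivWithin w (Icc 0 T) s, derivWithin z (Icc 0 T) s) := by
    intro s hs
    rw [(hode s hs).1, (hode s hs).2, stateRhs, hye s hs, hfields s hs]
  have hci : ∀ {v : ℝ → R3}, IsC1Zero T v →
      IntervalIntegrable (derivWithin v (Icc 0 T)) volume 0 t := fun {v} hv =>
    ((hv.1.continuousOn_derivWithin (uniqueDiffOn_Icc hT) le_rfl).mono (by
      rw [uIcc_of_le ht.1]; exact Icc_subset_Icc le_rfl ht.2)).intervalIntegrable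
  rw [hye t ht, hw.eq_integral hT ht, hz.eq_integral hT ht]
  have : ∫ s in (0 : ℝ)..t, stateRhs hA D q m c r₀ p₀ (WithLp.toLp 2 (E₀, B₀)) u η' y s =
      ∫ s in (0 : ℝ)..t, (derivWithin w (Icc 0 T) s, derivWithin z (Icc 0 T) s) := by
    refine intervalIntegral.integral_congr fun s hs => ?_
    rw [uIcc_of_le ht.1] at hs
    exact hrhs s ⟨hs.1, hs.2.trans ht.2⟩
  rw [this]
  simp only [intervalIntegral.integral_of_le ht.1]
  exact (integral_pair (hci hw).1 (hci hz).1).symm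

theorem norm_toLp_prod_le (a b : R3) :
    ‖(WithLp.toLp 2 (a, b) : WithLp 2 (R3 × R3))‖ ≤ ‖a‖ + ‖b‖ := by
  rw [WithLp.prod_norm_eq_of_L2]
  refine Real.sqrt_le_iff.2 ⟨by positivity, ?_⟩
  change ‖a‖ ^ 2 + ‖b‖ ^ 2 ≤ _
  nlinarith [norm_nonneg a, norm_nonneg b, mul_nonneg (norm_nonneg a) (norm_nonneg b)]

/-- Vanishing at `0` lets the derivative control the function, at the cost of a factor `T`. -/
theorem c1Norm_le (hT : 0 < T) {w z : ℝ → R3} (hw : IsC1Zero T w) (hz : IsC1Zero T z) {a b : ℝ}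
    (ha : ∀ t ∈ Icc 0 T, ‖derivWithin w (Icc 0 T) t‖ ≤ a)
    (hb : ∀ t ∈ Icc 0 T, ‖derivWithin z (Icc 0 T) t‖ ≤ b) :
    c1Norm T w z ≤ (T + 1) * (a + b) := by
  have : Nonempty (Icc (0 : ℝ) T) := ⟨⟨0, le_rfl, hT.le⟩⟩
  have key : ∀ {v : ℝ → R3} {a : ℝ}, IsC1Zero T v →
      (∀ t ∈ Icc 0 T, ‖derivWithin v (Icc 0 T) t‖ ≤ a) → ∀ t ∈ Icc 0 T, ‖v t‖ ≤ T * a := by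
    intro v a hv hva t ht
    have ha0 : 0 ≤ a := (norm_nonneg _).trans (hva t ht)
    rw [hv.eq_integral hT ht]
    refine (intervalIntegral.norm_integral_le_of_norm_le_const (C := a) fun s hs => ?_).trans ?_
    · rw [uIoc_of_le ht.1] at hs
      exact hva s ⟨hs.1.le, hs.2.trans ht.2⟩
    · rw [sub_zero, abs_of_nonneg ht.1, mul_comm]
      exact mul_le_mul_of_nonneg_right ht.2 ha0
  have h1 : (⨆ t : Icc (0 : ℝ) T, ‖(WithLp.toLp 2 (w t, z t) : WithLp 2 (R3 × R3))‖) ≤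
      T * a + T * b := ciSup_le fun t => (norm_toLp_prod_le _ _).trans
        (add_le_add (key hw ha t t.2) (key hz hb t t.2))
  have h2 : (⨆ t : Icc (0 : ℝ) T, ‖(WithLp.toLp 2 (derivWithin w (Icc 0 T) t,
      derivWithin z (Icc 0 T) t) : WithLp 2 (R3 × R3))‖) ≤ a + b :=
    ciSup_le fun t => (norm_toLp_prod_le _ _).trans (add_le_add (ha t t.2) (hb t t.2))
  calc c1Norm T w z ≤ (T * a + T * b) + (a + b) := add_le_add h1 h2
    _ = _ := by ring

end Abraham

end

/-! ### Well-posedness and the a priori bound -/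

theorem theorem4p1 (Ω : Set Abraham.R3) (hopen : IsOpen Ω) (hbdd : Bornology.IsBounded Ω)
    (hsc : IsSimplyConnected Ω) (harea : Abraham.surf Ω Set.univ < ⊤)
    (hreg : Abraham.PoissonRegular Ω)
    (T : ℝ) (hT : 0 < T) (D : Abraham.SmearedDelta)
    (q m c : ℝ) (hq : 0 < q) (hm : 0 < m) (hc : 0 < c)
    (r₀ p₀ : Abraham.R3) (E₀ B₀ : Abraham.X Ω) :
    ∃ C₁ > 0, ∃ C₂ > 0, ∀ u : Abraham.L2Γ Ω,
      ∃ w z : ℝ → Abraham.R3,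
        Abraham.IsReducedSolution Ω T D q m c r₀ p₀ E₀ B₀ u w z ∧
        (∀ w' z' : ℝ → Abraham.R3,
          Abraham.IsReducedSolution Ω T D q m c r₀ p₀ E₀ B₀ u w' z' →
            Set.EqOn w' w (Set.Icc 0 T) ∧ Set.EqOn z' z (Set.Icc 0 T)) ∧
        Abraham.c1Norm T w z ≤ C₁ * ‖u‖ + C₂ := by
  have : MeasureTheory.IsFiniteMeasure (Abraham.vol Ω) := ⟨by simpa using hbdd.measure_lt_top⟩
  have : MeasureTheory.IsFiniteMeasure (Abraham.surf Ω) := ⟨harea⟩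
  have hA := Abraham.isMaximalSkew_maxwellGraph hopen hbdd
  obtain ⟨S, hS⟩ := Abraham.exists_isVeryWeakSolution_iff hopen hbdd hreg
  obtain ⟨J, hJ0, hJ, -⟩ := Abraham.exists_current_bound (Ω := Ω) D hm hc q
  obtain ⟨A, hA0, hF, -⟩ := Abraham.exists_force_bound (Ω := Ω) D hm hc q
  set V₀ : Abraham.XX Ω := WithLp.toLp 2 (E₀, B₀) with hV₀
  -- The force bound splits into a part linear in `‖u‖`, through `‖η‖ ≤ ‖S‖ ‖u‖` and the boundary
  -- term, and a part from the speed limit `c` and the fields. The extra `1` makes the first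
  -- constant strictly positive even if `A = 0`; the second is positive because `c > 0`.
  refine ⟨(T + 1) * (A * (‖S‖ + 1)) + 1, by positivity,
    (T + 1) * (c + A * (‖V₀‖ + J * T)), by positivity, fun u => ?_⟩
  obtain ⟨L, hL, hcausal⟩ :=
    Abraham.exists_isCausal_stateRhs hA D hm hc hT.le q r₀ p₀ V₀ u (S u)
  obtain ⟨Y, f, hf, hY, hY0, hfY⟩ := hcausal.exists_solution hT.le hL
  have hsol := Abraham.isReducedSolution_of_hasDerivAt hA hT D hm hc ((hS u (S u)).2 rfl) hf hY
    hY0 hfY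
  refine ⟨fun t => (Y t).1, fun t => (Y t).2, hsol, fun w' z' h' => ?_, ?_⟩
  · obtain ⟨y, hy, hye, hyi⟩ := hsol.exists_integral_eq hA hT fun η => (hS u η).1
    obtain ⟨y', hy', hye', hyi'⟩ := h'.exists_integral_eq hA hT fun η => (hS u η).1
    have heq := hcausal.unique hT.le hL hy' hy hyi' hyi
    have hpair : ∀ t ∈ Set.Icc 0 T, (w' t, z' t) = ((Y t).1, (Y t).2) := fun t ht => by
      rw [← hye' t ht, ← hye t ht, heq ht]
    exact ⟨fun t ht => congrArg Prod.fst (hpair t ht), fun t ht => congrArg Prod.snd (hpair t ht)⟩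
  · have hu : UniqueDiffOn ℝ (Set.Icc 0 T) := uniqueDiffOn_Icc hT
    refine (Abraham.c1Norm_le hT hsol.1 hsol.2.1 (a := c)
      (b := A * (‖V₀‖ + J * T + ‖S‖ * ‖u‖ + ‖u‖)) (fun t ht => ?_) fun t ht => ?_).trans ?_
    · have hd : HasDerivAt (fun t => (Y t).1) (f t).1 t := (hY t).fst
      rw [hd.hasDerivWithinAt.derivWithin (hu t ht), hfY ht]
      exact Abraham.norm_velocity_le hm hc _
    · have hd : HasDerivAt (fun t => (Y t).2) (f t).2 t := (hY t).snd
      rw [hd.hasDerivWithinAt.derivWithin (hu t ht), hfY ht]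
      refine (hF _ _ _ _ _).trans (mul_le_mul_of_nonneg_left ?_ hA0)
      exact add_le_add (add_le_add (hA.norm_duhamel_le V₀ (fun _ => hJ _ _) ht) (S.le_opNorm u))
        le_rfl
    -- The two sides differ by exactly the `‖u‖` coming from that extra `1`.
    · linear_combination norm_nonneg u
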